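/- Let $k$ be an algebraically closed field of characteristic $p>0$ and let $C$ be a smooth projective curve over $k$ that is a Tango curve: there are an ample effective divisor $D$ on $C$ and a rational function $f\in K(C)\setminus K(C)^p$ with $(df)=pD$; put $L=\mathcal O_C(D)$. Let $B^1=\mathrm{coker}(\mathcal O_C\to F_*\mathcal O_C)$, where $F$ is the absolute Frobenius, identified with the sheaf of exact differentials, so that $df\in H^0(C,B^1\otimes L^{-1})$. Let $\eta\in H^1(C,L^{-1})$ be the image of $df$ under the connecting map of $0\to L^{-1}\to F_*\mathcal O_C\otimes L^{-1}\to B^1\otimes L^{-1}\to 0$, and let $0\to\mathcal O_C\to\mathcal E\to L\to 0$ be the extension with class $\eta$. Let $\pi\colon P=\mathbb P(\mathcal E)\to C$ be the associated ruled surface (parametrizing one-dimensional quotients of $\mathcal E$), and let $E\subset P$ be the image of the section $\sigma$ of $\pi$ given by the quotient $\mathcal E\to L$. The class $\eta$ is killed by Frobenius pullback, and the resulting splitting $F^*L\to F^*\mathcal E\subset \mathrm{Sym}^p\mathcal E$ defines a section of $\mathcal O_P(p)\otimes\pi^*L^{-p}$; let $C''\subset P$ be its zero divisor. Let $l$ be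 a positive integer dividing $p+1$, put $m=(p+1)/l$, and let $N$ be a line bundle on $C$ with $N^{l}\cong L$. Let $M=\mathcal O_P(-m)\otimes\pi^*N^{p}$, fix an isomorphism $M^{-l}\cong\mathcal O_P(E+C'')$, let $\psi\colon X=\mathbf{Spec}\bigl(\bigoplus_{i=0}^{l-1}M^i\bigr)\to P$ be the resulting cyclic cover of degree $l$, and let $\tilde E=\psi^{-1}(E)_{\mathrm{red}}$. Let $n$ be a positive integer and write $n=ql+r$ with integers $q\ge 0$ and $0\le r<l$. Then there is an isomorphism of $\mathcal O_P$-modules $$\psi_*\mathcal O_X(-n\tilde E)\;\cong\;\Bigl(\bigoplus_{i=0}^{r-1}M^i(-(q+1)E)\Bigr)\oplus\Bigl(\bigoplus_{i=r}^{l-1}M^i(-qE)\Bigr).$$ -/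

import Mathlib

open CategoryTheory CategoryTheory.Limits TopologicalSpace AlgebraicGeometry

universe u

noncomputable section

namespace TangoCover

section Divisors

variable (X : Scheme.{u}) [IsIntegral X]

/-- The local ring `𝒪_{X,x}`, viewed as a subring of the function field `K(X)`. -/
def localRing (x : X) : Subring X.functionField :=
  (algebraMap (X.presheaf.stalk x) X.functionField).range

/-- The subgroup `𝒪_{X,x}ˣ` of `K(X)ˣ`. -/
def stalkUnits (x : X) : Subgroup X.functionFieldˣ :=
  (Units.map (algebraMap (X.presheaf.stalk x) X.functionField).toMonoidHom).range

/-- The multiplicative group of Cartier divisors of the integral scheme `X`, i.e. the global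
sections of `K(X)ˣ / 𝒪_Xˣ`: families of classes in `K(X)ˣ / 𝒪_{X,x}ˣ` which locally on `X` are
induced by one rational function. -/
def cartierSubgroup : Subgroup (∀ x : X, X.functionFieldˣ ⧸ stalkUnits X x) where
  carrier := {δ | ∀ x : X, ∃ U : X.Opens, x ∈ U ∧ ∃ g : X.functionFieldˣ,
    ∀ z ∈ U, δ z = (g : X.functionFieldˣ ⧸ stalkUnits X z)}
  mul_mem' := by
    intro a b ha hb x
    obtain ⟨U, hU, g, hg⟩ := ha x
    obtain ⟨V, hV, h, hh⟩ := hb x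
    refine ⟨U ⊓ V, ⟨hU, hV⟩, g * h, fun z hz => ?_⟩
    rw [Pi.mul_apply, hg z hz.1, hh z hz.2, QuotientGroup.mk_mul]
  one_mem' := fun x => ⟨⊤, trivial, 1, fun z _ => rfl⟩
  inv_mem' := by
    intro a ha x
    obtain ⟨U, hU, g, hg⟩ := ha x
    exact ⟨U, hU, g⁻¹, fun z hz => by rw [Pi.inv_apply, hg z hz, QuotientGroup.mk_inv]⟩

/-- The (additively written) group of Cartier divisors of an integral scheme. -/
def CartierDivisor : Type u := Additive (cartierSubgroup X)

instance : AddCommGroup (CartierDivisor X) :=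
  inferInstanceAs (AddCommGroup (Additive (cartierSubgroup X)))

variable {X}

/-- The class in `K(X)ˣ / 𝒪_{X,x}ˣ` of the local equations of `Δ` at `x`. -/
def CartierDivisor.eqn (Δ : CartierDivisor X) (x : X) : X.functionFieldˣ ⧸ stalkUnits X x :=
  (Additive.toMul (α := cartierSubgroup X) Δ).1 x

/-- The principal divisor `div(g)`. -/
def principalDivisor (g : X.functionFieldˣ) : CartierDivisor X :=
  Additive.ofMul (α := cartierSubgroup X) ⟨fun _ => (g : X.functionFieldˣ ⧸ _), fun _ => ⟨⊤, trivial, g, fun _ _ => rfl⟩⟩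

/-- The stalk `𝒪_X(Δ)_x ⊆ K(X)`: all `g` with `g * u ∈ 𝒪_{X,x}` for the local equations `u` of `Δ`
at `x`. -/
def CartierDivisor.stalk (Δ : CartierDivisor X) (x : X) :
    Submodule (X.presheaf.stalk x) X.functionField where
  carrier := {g | ∀ u : X.functionFieldˣ, (u : X.functionFieldˣ ⧸ stalkUnits X x) = Δ.eqn x →
    g * u ∈ localRing X x}
  add_mem' := by
    intro a b ha hb u hu
    rw [add_mul]
    exact add_mem (ha u hu) (hb u hu)
  zero_mem' := fun u _ => by rw [zero_mul]; exact zero_mem _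
  smul_mem' := by
    intro c a ha u hu
    rw [Algebra.smul_def, mul_assoc]
    exact mul_mem ⟨c, rfl⟩ (ha u hu)

/-- `Δ ≥ 0`, i.e. the local equations are regular. -/
def CartierDivisor.IsEffective (Δ : CartierDivisor X) : Prop :=
  ∀ x, (1 : X.functionField) ∈ Δ.stalk x

/-- `Δ` is the divisor whose ideal sheaf `𝒪_X(-Δ) ⊆ 𝒪_X` is `I`; in other words, `Δ` is the closed
subscheme `V(I)`. -/
def CartierDivisor.IsDivisorOf (Δ : CartierDivisor X) (I : X.IdealSheafData) : Prop :=
  ∀ (U : X.affineOpens) [Nonempty (U : X.Opens)] (s : Γ(X, U)),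
    s ∈ I.ideal U ↔ ∀ x ∈ (U : X.Opens), X.germToFunctionField U s ∈ (-Δ).stalk x

end Divisors

section LineBundle

variable {X : Scheme.{u}} [IsIntegral X]

/-- Arbitrary functions on `U` with values in the function field `K(X)`. -/
def Values (X : Scheme.{u}) [IsIntegral X] (U : X.Opens) : Type u := U → X.functionField

instance (U : X.Opens) : AddCommGroup (Values X U) :=
  inferInstanceAs (AddCommGroup (U → X.functionField))

/-- The value at each point of `U` (an element of `K(X)`) of a section of `𝒪_X` over `U`. -/
def sectionValues (U : X.Opens) : Γ(X, U) →+* (U → X.functionField) :=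
  RingHom.pi fun x => (algebraMap (X.presheaf.stalk x.1) X.functionField).comp
    (X.presheaf.germ U x.1 x.2).hom

lemma sectionValues_apply (U : X.Opens) (a : Γ(X, U)) (x : U) :
    sectionValues U a x = algebraMap (X.presheaf.stalk x.1) X.functionField
      (X.presheaf.germ U x.1 x.2 a) := rfl

lemma sectionValues_const (U : X.Opens) (a : Γ(X, U)) (x y : U) :
    sectionValues U a x = sectionValues U a y := by
  have : Nonempty U := ⟨x⟩
  rw [sectionValues_apply, sectionValues_apply, Scheme.algebraMap_germ_eq_germToFunctionField,
    Scheme.algebraMap_germ_eq_germToFunctionField]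

instance (U : X.Opens) : Module Γ(X, U) (Values X U) :=
  Module.compHom (U → X.functionField) (sectionValues U)

lemma smul_values (U : X.Opens) (a : Γ(X, U)) (s : Values X U) (x : U) :
    (a • s) x = sectionValues U a x * s x := rfl

/-- The sections of `𝒪_X(Δ)` over `U`: for nonempty `U` these are the rational functions lying in
all stalks `𝒪_X(Δ)_x` with `x ∈ U`. They are written as constant functions on `U`, so that there is
exactly one section over the empty set. -/
def CartierDivisor.sections (Δ : CartierDivisor X) (U : X.Opens) :
    Submodule Γ(X, U) (Values X U) where
  carrier := {s | (∀ x y, s x = s y) ∧ ∀ x : U, s x ∈ Δ.stalk x.1}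
  add_mem' := by
    rintro a b ⟨ha, ha'⟩ ⟨hb, hb'⟩
    refine ⟨fun x y => ?_, fun x => add_mem (ha' x) (hb' x)⟩
    change a x + b x = a y + b y
    rw [ha x y, hb x y]
  zero_mem' := ⟨fun _ _ => rfl, fun _ => zero_mem _⟩
  smul_mem' := by
    rintro c a ⟨ha, ha'⟩
    refine ⟨fun x y => ?_, fun x => ?_⟩
    · rw [smul_values, smul_values, ha x y, sectionValues_const U c x y]
    · rw [smul_values, sectionValues_apply, ← Algebra.smul_def]
      exact Submodule.smul_mem _ _ (ha' x)

/-- Restriction of sections of `𝒪_X(Δ)`. -/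
def CartierDivisor.res (Δ : CartierDivisor X) {U V : X.Opens} (h : V ≤ U) :
    Δ.sections U →+ Δ.sections V :=
  AddMonoidHom.mk' (fun s => ⟨fun x => s.1 ⟨x.1, h x.2⟩, fun x y => s.2.1 ⟨x.1, h x.2⟩ ⟨y.1, h y.2⟩,
    fun x => s.2.2 ⟨x.1, h x.2⟩⟩) (fun _ _ => rfl)

/-- The presheaf of modules `𝒪_X(Δ)`. -/
def CartierDivisor.presheafOfModules (Δ : CartierDivisor X) : X.PresheafOfModules where
  obj U := ModuleCat.of Γ(X, U.unop) (Δ.sections U.unop)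
  map {U V} f := ModuleCat.homMk (AddCommGrpCat.ofHom (Δ.res f.unop.le)) (by
    intro r
    ext m
    refine Subtype.ext (funext fun x => ?_)
    change sectionValues V.unop (X.presheaf.map f r) x * m.1 ⟨x.1, f.unop.le x.2⟩ =
      sectionValues U.unop r ⟨x.1, f.unop.le x.2⟩ * m.1 ⟨x.1, f.unop.le x.2⟩
    rw [sectionValues_apply, sectionValues_apply]
    congr 2
    exact X.presheaf.germ_res_apply f.unop x.1 x.2 r)
  map_id U := rfl
  map_comp f g := rfl

/-- The invertible sheaf `𝒪_X(Δ)` of a Cartier divisor `Δ`, as a sheaf of `𝒪_X`-modules. -/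
def CartierDivisor.lineBundle (Δ : CartierDivisor X) : X.Modules where
  val := Δ.presheafOfModules
  isSheaf := by
    refine (TopCat.Presheaf.isSheaf_iff_isSheafUniqueGluing
      (X := X.toTopCat) Δ.presheafOfModules.presheaf).mpr ?_
    intro ι U sf hsf
    have key : ∀ i j (x : X) (hi : x ∈ U i) (hj : x ∈ U j),
        (sf i).1 ⟨x, hi⟩ = (sf j).1 ⟨x, hj⟩ := by
      intro i j x hi hj
      have := congrArg (fun s : Δ.sections (U i ⊓ U j) => s.1 ⟨x, hi, hj⟩) (hsf i j)
      exact this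
    have hmem : ∀ x : (iSup U : X.Opens), ∃ i, x.1 ∈ U i := fun x => Opens.mem_iSup.mp x.2
    choose c hc using hmem
    have key' : ∀ i j (x : U i) (y : U j), (sf i).1 x = (sf j).1 y := by
      intro i j x y
      obtain ⟨z, hzi, hzj⟩ := nonempty_preirreducible_inter (X := X)
        (show IsOpen (SetLike.coe (U i)) from (U i).isOpen)
        (show IsOpen (SetLike.coe (U j)) from (U j).isOpen)
        ⟨x.1, x.2⟩ ⟨y.1, y.2⟩
      rw [(sf i).2.1 x ⟨z, hzi⟩, key i j z hzi hzj, (sf j).2.1 ⟨z, hzj⟩ y]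
    refine ⟨⟨fun x => (sf (c x)).1 ⟨x.1, hc x⟩, fun x y => key' _ _ _ _,
      fun x => (sf (c x)).2.2 ⟨x.1, hc x⟩⟩, fun i => ?_, fun t ht => ?_⟩
    · exact Subtype.ext (funext fun x => key' _ _ _ _)
    · refine Subtype.ext (funext fun x => ?_)
      have := congrArg (fun s : Δ.sections (U (c x)) => s.1 ⟨x.1, hc x⟩) (ht (c x))
      exact this

end LineBundle

section Pullback

variable {X Y : Scheme.{u}} [IsIntegral X] [IsIntegral Y] (f : X ⟶ Y) [IsDominant f]

lemma specializes_genericPoint : f (genericPoint X) ⤳ genericPoint Y := by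
  have h : IsGenericPoint (f (genericPoint X)) (⊤ : Set Y) := by
    have := (genericPoint_spec X).image f.continuous
    rw [Set.image_univ, f.denseRange.closure_range] at this
    exact this
  rw [h.eq (genericPoint_spec Y)]

/-- The embedding of function fields `K(Y) → K(X)` induced by a dominant morphism `X ⟶ Y`. -/
def functionFieldMap : Y.functionField →+* X.functionField :=
  (Y.presheaf.stalkSpecializes (specializes_genericPoint f) ≫ f.stalkMap (genericPoint X)).hom

lemma functionFieldMap_algebraMap (x : X) (a : Y.presheaf.stalk (f x)) :
    functionFieldMap f (algebraMap (Y.presheaf.stalk (f x)) Y.functionField a) =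
      algebraMap (X.presheaf.stalk x) X.functionField (f.stalkMap x a) := by
  have h := Scheme.Hom.stalkSpecializes_stalkMap f (genericPoint X) x
    ((genericPoint_spec X).specializes trivial)
  have h' := congrArg (fun φ => φ.hom a) h
  simp only [CommRingCat.hom_comp, RingHom.comp_apply] at h'
  refine Eq.trans ?_ h'
  simp only [functionFieldMap, CommRingCat.hom_comp, RingHom.comp_apply]
  congr 1
  exact TopCat.Presheaf.stalkSpecializes_comp_apply _ _ _ _

/-- The pullback `f^*Δ` of a Cartier divisor along a dominant morphism: its local equations are the
pullbacks of those of `Δ`. -/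
def CartierDivisor.pullback (Δ : CartierDivisor Y) : CartierDivisor X :=
  Additive.ofMul (α := cartierSubgroup X)
    ⟨fun x => QuotientGroup.map (stalkUnits Y (f x)) (stalkUnits X x)
      (Units.map (functionFieldMap f).toMonoidHom) (by
        rintro _ ⟨v, rfl⟩
        refine ⟨Units.map (f.stalkMap x).hom.toMonoidHom v, Units.ext ?_⟩
        exact (functionFieldMap_algebraMap f x v).symm) (Δ.eqn (f x)), by
      intro x
      obtain ⟨U, hU, g, hg⟩ := (Additive.toMul (α := cartierSubgroup Y) Δ).2 (f x)
      refine ⟨f ⁻¹ᵁ U, hU, Units.map (functionFieldMap f).toMonoidHom g, fun z hz => ?_⟩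
      have hz' : Δ.eqn (f z) = (g : Y.functionFieldˣ ⧸ stalkUnits Y (f z)) := hg (f z) hz
      exact congrArg (QuotientGroup.map (stalkUnits Y (f z)) (stalkUnits X z) _ _) hz'⟩

end Pullback

section Tango

variable {k : Type u} [Field k] {C : Scheme.{u}} [IsIntegral C] (c : C ⟶ Spec (.of k))

/-- The embedding of the ground field into the function field of a `k`-scheme. -/
def scalarMap : k →+* C.functionField :=
  (C.presheaf.germ ⊤ (genericPoint C) trivial).hom.comp (c.appTop.hom.comp (Scheme.ΓSpecIso (.of k)).inv.hom)

/-- The function field, viewed as an algebra over the ground field. -/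
abbrev functionFieldAlgebra : Algebra k C.functionField := (scalarMap c).toAlgebra

/-- `(df) = p D`, for a rational function `f` and a divisor `D` on a smooth curve `C`: if `u` is a
local equation of `D` at `x`, then `u⁻ᵖ df` generates the `𝒪_{C,x}`-module of Kähler differentials
that are regular at `x`. -/
def HasDifferentialDivisor (p : ℕ) (D : CartierDivisor C) (f : C.functionField) : Prop :=
  letI := functionFieldAlgebra c
  ∀ (x : C) (u : C.functionFieldˣ), (u : C.functionFieldˣ ⧸ stalkUnits C x) = D.eqn x →
    Submodule.span (localRing C x)
        {((u⁻¹ ^ p : C.functionFieldˣ) : C.functionField) • KaehlerDifferential.D k _ f} =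
      Submodule.span (localRing C x)
        (KaehlerDifferential.D k C.functionField '' (localRing C x : Set C.functionField))

/-- `D` is an ample effective divisor on the curve `C` (i.e. `D` is effective and nonzero),
`f ∈ K(C)` is not a `p`-th power and `(df) = p D`: then `L = 𝒪_C(D)` is a Tango structure. -/
structure IsTangoStructure (p : ℕ) (D : CartierDivisor C) (f : C.functionField) : Prop where
  effective : D.IsEffective
  ne_zero : D ≠ 0
  not_pow : ∀ g : C.functionField, g ^ p ≠ f
  div_eq : HasDifferentialDivisor c p D f

/-- The family `e` of rational functions represents the class `η ∈ H¹(C, L⁻¹)`, `L = 𝒪_C(D)`, which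
is the image of `df ∈ H⁰(C, B¹ ⊗ L⁻¹)` under the connecting map of
`0 → L⁻¹ → F_*𝒪_C ⊗ L⁻¹ = F_*(𝒪_C(-pD)) → B¹ ⊗ L⁻¹ → 0`. Indeed near `x` the local section
`f - e_x ^ p` of `F_*(𝒪_C(-pD))` lifts `df`; the differences of these lifts are the `p`-th powers of
the cocycle `e_x - e_z` with values in `L⁻¹ = 𝒪_C(-D)`. -/
structure RepresentsTangoClass (p : ℕ) (D : CartierDivisor C) (f : C.functionField)
    (e : C → C.functionField) : Prop where
  lift : ∀ x, f - e x ^ p ∈ (-(p • D)).stalk x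
  coherent : ∀ x, ∃ U : C.Opens, x ∈ U ∧ ∀ z ∈ U, e x - e z ∈ (-D).stalk z

/-- The stalk at `x` of the vector bundle `ℰ` of rank two which is the extension
`0 → 𝒪_C → ℰ → 𝒪_C(D) → 0` with class given by the cocycle `e_x - e_z`. It is the subsheaf of
`K(C) ⊕ K(C)` of all pairs `(a, b)` with `b ∈ 𝒪_C(D)_x` and `a - e_x b ∈ 𝒪_{C,x}`; the maps of the
extension are `a ↦ (a, 0)` and `(a, b) ↦ b`. -/
def extensionStalk (D : CartierDivisor C) (e : C → C.functionField) (x : C) :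
    Set (C.functionField × C.functionField) :=
  {s | s.2 ∈ D.stalk x ∧ s.1 - e x * s.2 ∈ localRing C x}

/-- The module `ℰ(U)` of sections over a nonempty open set `U`. -/
def extensionSections (D : CartierDivisor C) (e : C → C.functionField) (U : C.Opens) [Nonempty U] :
    Submodule Γ(C, U) (C.functionField × C.functionField) where
  carrier := {s | ∀ x ∈ U, s ∈ extensionStalk D e x}
  add_mem' := by
    intro a b ha hb x hx
    refine ⟨add_mem (ha x hx).1 (hb x hx).1, ?_⟩
    have := add_mem (ha x hx).2 (hb x hx).2
    convert this using 1
    simp only [Prod.fst_add, Prod.snd_add]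
    ring
  zero_mem' := fun x _ => ⟨zero_mem _, by simp [zero_mem]⟩
  smul_mem' := by
    intro r a ha x hx
    have hr : algebraMap Γ(C, U) C.functionField r =
        algebraMap (C.presheaf.stalk x) C.functionField (C.presheaf.germ U x hx r) :=
      (Scheme.algebraMap_germ_eq_germToFunctionField C hx r).symm
    refine ⟨?_, ?_⟩
    · rw [Prod.smul_snd, Algebra.smul_def, hr, ← Algebra.smul_def]
      exact Submodule.smul_mem _ _ (ha x hx).1
    · have := mul_mem (show algebraMap Γ(C, U) C.functionField r ∈ localRing C x from ⟨_, hr.symm⟩)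
        (ha x hx).2
      convert this using 1
      rw [Prod.smul_fst, Prod.smul_snd, Algebra.smul_def, Algebra.smul_def]
      ring

end Tango

section RuledSurface

variable {C P : Scheme.{u}} [IsIntegral C] [IsIntegral P] (π : P ⟶ C) [IsDominant π]

/-- With homogeneous coordinates `X = (1, 0)` and `Y = (0, 1)` of `ℙ(ℰ)` over the generic point of
`C` and `y = Y / X`, the rational function `(a X + b Y) / X = a + b y` on `ℙ(ℰ)` given by
`s = (a, b)`. -/
def linearForm (y : P.functionField) (s : C.functionField × C.functionField) : P.functionField :=
  functionFieldMap π s.1 + functionFieldMap π s.2 * y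

/-- The coordinate ring of the affine open `V ⊆ P`, as a subring of `K(P)`, is `Γ(C, U)[t / s]`, the
coordinate ring of the open set `s ≠ 0` of the projective line over `U` with coordinates `s, t`. -/
def IsChart (y : P.functionField) (U : C.Opens) [Nonempty U] (V : P.Opens) [Nonempty V]
    (s t : C.functionField × C.functionField) : Prop :=
  (P.germToFunctionField V).hom.range =
    Subring.closure (functionFieldMap π '' Set.range (C.germToFunctionField U) ∪
      {linearForm π y t / linearForm π y s})

/-- `π : P ⟶ C` is the projective bundle `ℙ(ℰ) = Proj (Sym ℰ)` of one-dimensional quotients of the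
extension `ℰ` of `𝒪_C(D)` by `𝒪_C` defined by `e`, with the rational function `y = Y / X`: if `ℰ` has
basis `s, t` over a nonempty affine open `U ⊆ C`, then `π⁻¹(U)` is glued from
`Spec Γ(C, U)[t / s]` and `Spec Γ(C, U)[s / t]`. -/
structure IsProjectiveBundle (D : CartierDivisor C) (e : C → C.functionField)
    (y : P.functionField) : Prop where
  isSeparated : IsSeparated π
  transcendental : ∀ g : Polynomial C.functionField, g.eval₂ (functionFieldMap π) y = 0 → g = 0
  charts : ∀ (U : C.Opens) [Nonempty U], IsAffineOpen U →
    ∀ b : Module.Basis (Fin 2) Γ(C, U) (extensionSections D e U),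
      ∃ (V W : P.Opens) (_ : Nonempty V) (_ : Nonempty W), IsAffineOpen V ∧ IsAffineOpen W ∧
        V ⊔ W = π ⁻¹ᵁ U ∧ IsChart π y U V (b 0).1 (b 1).1 ∧ IsChart π y U W (b 1).1 (b 0).1

/-- `H` is the divisor with `𝒪_P(H) = 𝒪_P(1)`, the image of `π^*ℰ` in `K(P)` under the
trivialization of `𝒪_P(1)` over the generic point by `X`. -/
def IsTautologicalDivisor (D : CartierDivisor C) (e : C → C.functionField) (y : P.functionField)
    (H : CartierDivisor P) : Prop :=
  ∀ w : P, H.stalk w =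
    Submodule.span (P.presheaf.stalk w) (linearForm π y '' extensionStalk D e (π w))

/-- `σ` is the section of `P = ℙ(ℰ)` attached to the quotient `ℰ → L = 𝒪_C(D)`, `(a, b) ↦ b`: if
the image of `t ∈ ℰ_x` generates `L_x`, then for all `s ∈ ℰ_x` the rational function `s / t` is
regular at `σ(x)`, and its pullback under `σ` is the ratio of the images of `s` and `t` in `L_x`. -/
structure IsQuotientSection (D : CartierDivisor C) (e : C → C.functionField) (y : P.functionField)
    (σ : C ⟶ P) : Prop where
  comp_eq : σ ≫ π = 𝟙 C
  pullback_eq : ∀ (x : C), ∀ s ∈ extensionStalk D e x, ∀ t ∈ extensionStalk D e x,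
    D.stalk x = Submodule.span (C.presheaf.stalk x) {t.2} →
    ∃ g : P.presheaf.stalk (σ x),
      algebraMap (P.presheaf.stalk (σ x)) P.functionField g =
        linearForm π y s / linearForm π y t ∧
      algebraMap (C.presheaf.stalk x) C.functionField (σ.stalkMap x g) = s.2 / t.2

/-- The multisection: the zero divisor of the section of
`𝒪_P(p) ⊗ π^*L⁻ᵖ = 𝒪_P(pH - p π^*D) ⊆ K(P)` given by the rational function `τ`. (For the section
which comes from the splitting `F^*L → F^*ℰ ⊆ Symᵖ ℰ`, `b ↦ b (f Xᵖ + Yᵖ)`, this function is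
`τ = f + yᵖ`.) -/
def multisection (p : ℕ) (D : CartierDivisor C) (H : CartierDivisor P) (τ : P.functionFieldˣ) :
    CartierDivisor P :=
  principalDivisor τ + p • H - p • D.pullback π

end RuledSurface

section Cover

instance (X : Scheme.{u}) : HasFiniteBiproducts X.Modules :=
  Abelian.hasFiniteBiproducts

variable {P X : Scheme.{u}} [IsIntegral P]

/-- The algebra `K(P)[T] / (Tˡ - θ)`. -/
abbrev GenericAlgebra (l : ℕ) (θ : P.functionField) : Type u :=
  AdjoinRoot (Polynomial.X ^ l - Polynomial.C θ : Polynomial P.functionField)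

/-- Let `M` be a divisor on `P` and `θ` a rational function such that multiplication by `θ` maps
`𝒪_P(lM)` into `𝒪_P`. This makes `𝒜 = ⨁_{i < l} 𝒪_P(iM)` an algebra, the subsheaf
`⨁_{i < l} 𝒪_P(iM) Tⁱ` of `K(P)[T] / (Tˡ - θ)`. The structure says that `X = Spec 𝒜`: the morphism
`ψ` is affine and `ψ_*𝒪_X ≅ 𝒜` as sheaves of `𝒪_P`-algebras. -/
structure CyclicCover (ψ : X ⟶ P) (l : ℕ) (M : CartierDivisor P) (θ : P.functionField) where
  isAffineHom : IsAffineHom ψ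
  toAlg (U : P.Opens) [Nonempty U] : Γ(X, ψ ⁻¹ᵁ U) →+* GenericAlgebra l θ
  injective (U : P.Opens) [Nonempty U] : Function.Injective (toAlg U)
  mem_range_iff (U : P.Opens) [Nonempty U] (a : GenericAlgebra l θ) :
    a ∈ (toAlg U).range ↔ ∃ g : Fin l → P.functionField,
      (∀ i : Fin l, ∀ w ∈ U, g i ∈ ((i : ℕ) • M).stalk w) ∧
      a = ∑ i : Fin l, AdjoinRoot.of _ (g i) * AdjoinRoot.root _ ^ (i : ℕ)
  map_res {U V : P.Opens} [Nonempty U] [Nonempty V] (h : V ≤ U) (s : Γ(X, ψ ⁻¹ᵁ U)) :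
    toAlg V (X.presheaf.map (homOfLE (ψ.preimage_mono h)).op s) = toAlg U s
  map_app (U : P.Opens) [Nonempty U] (a : Γ(P, U)) :
    toAlg U (ψ.app U a) = AdjoinRoot.of _ (P.germToFunctionField U a)

/-- The ideal of the reduced preimage `ψ⁻¹(Z)_red` of the closed subset `Z`. -/
def reducedPreimage (ψ : X ⟶ P) (Z : Closeds P) : X.IdealSheafData :=
  Scheme.IdealSheafData.vanishingIdeal (Z.preimage ψ.continuous)

/-- The ideal sheaf `I ⊆ 𝒪_X` as a sheaf of `𝒪_X`-modules: the kernel of `𝒪_X → i_*𝒪_{V(I)}`,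
where `i : V(I) ⟶ X` is the inclusion. -/
def idealSheaf (I : X.IdealSheafData) : X.Modules :=
  kernel (C := X.Modules) (X := SheafOfModules.unit X.ringCatSheaf)
    (Y := (Scheme.Modules.pushforward I.subschemeι).obj
      (SheafOfModules.unit I.subscheme.ringCatSheaf))
    (SheafOfModules.unitToPushforwardObjUnit I.subschemeι.toRingCatSheafHom)

end Cover

end TangoCover

end

open TangoCover

/-! The statement is local on `P` up to bookkeeping in the function field. Over a small affine open
with coordinate ring `R ⊆ K(P)`, let `m` and `t` be local equations of `M` and `E`. The algebra of
`X` is the direct sum of the `R Zⁱ`, `i < l`, with `Z = m⁻¹ T` and `Zˡ = m⁻ˡ θ`. Since `div θ = lM +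
E + B` and `B` misses `E`, near `E` one has `Zˡ = ε t` with a unit `ε`. So `Z` is nilpotent modulo
`t`, and the quotient by `Z` is `R/tR`, which is reduced because `E` is the image of the reduced
curve `C`. Hence `Z` generates the ideal of the reduced preimage, and `Zⁿ` generates its `n`-th
power (`mem_pow_radical_iff`). Multiplication by `Z` rotates the coefficients and costs one factor
`t` per full turn, so membership in `(Zⁿ)` means that the coefficient of `Zⁱ` is divisible by `t ^
⌈(n - i) / l⌉`; this exponent is `q + 1` for `i < r` and `q` for `i ≥ r`. Away from `E` the function
`t` is a unit and both conditions are empty.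

The coefficients of the powers of `T` are global: they are elements of `K(P)` independent of the
chosen equations. The local descriptions therefore combine
(`CyclicCover.app_subschemeι_eq_zero_iff`), and taking coefficients and multiplying by `Tⁱ` are the
projections and inclusions of the direct sum (`CyclicCover.nonempty_pushforward_iso`).

Two geometric facts feed this. The multisection is disjoint from the section
(`eqn_multisection_eq_one`): along `σ` its local equation is `1` plus a multiple of a function
vanishing on `σ`. Moreover `E` equals the tautological divisor `H` (`eq_of_isDivisorOf_ker`), which
makes `E` effective: `θ` yields linear equivalence, the equations of `H` vanish on the section, and
global functions on `P` are constants from the field of global functions of the proper curve `C`. -/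

noncomputable section

namespace TangoCover

/-! ### Regular functions as elements of the function field -/

section LocalRings

variable {X : Scheme.{u}} [IsIntegral X]

lemma germToFunctionField_mem_localRing {U : X.Opens} [Nonempty U] {x : X} (hx : x ∈ U)
    (s : Γ(X, U)) : X.germToFunctionField U s ∈ localRing X x :=
  ⟨X.presheaf.germ U x hx s, Scheme.algebraMap_germ_eq_germToFunctionField X hx s⟩

lemma germToFunctionField_res {U V : X.Opens} [Nonempty U] [Nonempty V] (h : V ≤ U)
    (s : Γ(X, U)) :
    X.germToFunctionField V (X.presheaf.map (homOfLE h).op s) = X.germToFunctionField U s :=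
  X.presheaf.germ_res_apply (homOfLE h) _ _ s

lemma exists_germ_of_mem_localRing {g : X.functionField} {x : X} (hg : g ∈ localRing X x) :
    ∃ U : X.Opens, ∃ _ : Nonempty U, x ∈ U ∧ ∃ s : Γ(X, U), X.germToFunctionField U s = g := by
  obtain ⟨a, rfl⟩ := hg
  obtain ⟨U, hx, s, rfl⟩ := X.presheaf.exists_germ_eq a
  have : Nonempty U := ⟨⟨x, hx⟩⟩
  exact ⟨U, this, hx, s, (Scheme.algebraMap_germ_eq_germToFunctionField X hx s).symm⟩

lemma eventually_mem_localRing {g : X.functionField} {x : X} (hg : g ∈ localRing X x) :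
    ∃ U : X.Opens, x ∈ U ∧ ∀ z ∈ U, g ∈ localRing X z := by
  obtain ⟨U, _, hx, s, rfl⟩ := exists_germ_of_mem_localRing hg
  exact ⟨U, hx, fun z hz => germToFunctionField_mem_localRing hz s⟩

/-- Local representatives glue because any two nonempty opens of an integral scheme meet, and
sections over the overlap are determined by their image in `K(X)`. -/
lemma exists_section_of_forall_mem_localRing (U : X.Opens) [Nonempty U] (g : X.functionField)
    (hg : ∀ x ∈ U, g ∈ localRing X x) : ∃ s : Γ(X, U), X.germToFunctionField U s = g := by
  choose V hV hx s hs using fun x : U => exists_germ_of_mem_localRing (hg x x.2)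
  have hle : U ≤ ⨆ x : U, V x := fun x h => Opens.mem_iSup.mpr ⟨⟨x, h⟩, hx ⟨x, h⟩⟩
  have hcompat : TopCat.Presheaf.IsCompatible X.presheaf (fun x : U => V x) s := by
    intro i j
    obtain ⟨z, hzi, hzj⟩ := nonempty_preirreducible_inter (X := X) (V i).isOpen (V j).isOpen
      ⟨i.1, hx i⟩ ⟨j.1, hx j⟩
    have : Nonempty (V i ⊓ V j : X.Opens) := ⟨⟨z, hzi, hzj⟩⟩
    apply X.germToFunctionField_injective (V i ⊓ V j)
    exact ((germToFunctionField_res inf_le_left (s i)).trans (hs i)).trans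
      ((germToFunctionField_res inf_le_right (s j)).trans (hs j)).symm
  obtain ⟨t, ht⟩ : ∃ t : Γ(X, ⨆ x : U, V x), ∀ x : U,
      X.presheaf.map (homOfLE (le_iSup V x)).op t = s x :=
    (X.sheaf.existsUnique_gluing (fun x : U => V x) s hcompat).exists
  have : Nonempty (⨆ x : U, V x : X.Opens) := ⟨⟨_, hle (Classical.arbitrary U).2⟩⟩
  refine ⟨X.presheaf.map (homOfLE hle).op t, ?_⟩
  let x : U := Classical.arbitrary U
  rw [germToFunctionField_res, ← hs x, ← ht x, germToFunctionField_res]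

lemma mem_stalkUnits_iff {g : X.functionFieldˣ} {x : X} :
    g ∈ stalkUnits X x ↔
      (g : X.functionField) ∈ localRing X x ∧ ((g⁻¹ : X.functionFieldˣ) : X.functionField) ∈ localRing X x := by
  constructor
  · rintro ⟨a, rfl⟩
    exact ⟨⟨a, rfl⟩, ⟨(a⁻¹ : (X.presheaf.stalk x)ˣ), by rw [← map_inv]; rfl⟩⟩
  · rintro ⟨⟨a, ha⟩, ⟨b, hb⟩⟩
    have hinj : Function.Injective (algebraMap (X.presheaf.stalk x) X.functionField) :=
      IsFractionRing.injective _ _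
    have hab : a * b = 1 := hinj (by rw [map_mul, ha, hb, map_one, Units.mul_inv])
    exact ⟨⟨a, b, hab, by rw [mul_comm, hab]⟩, Units.ext ha⟩

lemma mk_eq_mk_iff {g h : X.functionFieldˣ} {x : X} :
    (g : X.functionFieldˣ ⧸ stalkUnits X x) = h ↔
      (h / g : X.functionField) ∈ localRing X x ∧ (g / h : X.functionField) ∈ localRing X x := by
  rw [QuotientGroup.eq, mem_stalkUnits_iff]
  simp only [Units.val_mul, mul_inv_rev, inv_inv, Units.val_inv_eq_inv_val]
  rw [mul_comm, ← div_eq_mul_inv, mul_comm, ← div_eq_mul_inv]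

variable {Y : Scheme.{u}} [IsIntegral Y] (f : X ⟶ Y) [IsDominant f]

lemma functionFieldMap_mem_localRing {x : X} {g : Y.functionField} (hg : g ∈ localRing Y (f x)) :
    functionFieldMap f g ∈ localRing X x := by
  obtain ⟨a, rfl⟩ := hg
  exact ⟨f.stalkMap x a, (functionFieldMap_algebraMap f x a).symm⟩

end LocalRings

/-! ### Calculus of local equations of Cartier divisors -/

namespace CartierDivisor

variable {X : Scheme.{u}} [IsIntegral X]

lemma eqn_add (Δ Δ' : CartierDivisor X) (x : X) : (Δ + Δ').eqn x = Δ.eqn x * Δ'.eqn x := rfl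

lemma eqn_neg (Δ : CartierDivisor X) (x : X) : (-Δ).eqn x = (Δ.eqn x)⁻¹ := rfl

lemma eqn_zero (x : X) : (0 : CartierDivisor X).eqn x = 1 := rfl

lemma eqn_sub (Δ Δ' : CartierDivisor X) (x : X) : (Δ - Δ').eqn x = Δ.eqn x / Δ'.eqn x := by
  rw [sub_eq_add_neg, eqn_add, eqn_neg, div_eq_mul_inv]

lemma eqn_nsmul (n : ℕ) (Δ : CartierDivisor X) (x : X) : (n • Δ).eqn x = Δ.eqn x ^ n := by
  induction n with
  | zero => rw [zero_smul, eqn_zero, pow_zero]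
  | succ n ih => rw [succ_nsmul, eqn_add, ih, pow_succ]

lemma eqn_principalDivisor (g : X.functionFieldˣ) (x : X) :
    (principalDivisor g).eqn x = (g : X.functionFieldˣ ⧸ stalkUnits X x) := rfl

lemma ext_eqn {Δ Δ' : CartierDivisor X} (h : ∀ x, Δ.eqn x = Δ'.eqn x) : Δ = Δ' :=
  congrArg (Additive.ofMul (α := cartierSubgroup X)) (Subtype.ext (funext h))

lemma exists_eqn (Δ : CartierDivisor X) (x : X) :
    ∃ U : X.Opens, x ∈ U ∧ ∃ g : X.functionFieldˣ,
      ∀ z ∈ U, (g : X.functionFieldˣ ⧸ stalkUnits X z) = Δ.eqn z := by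
  obtain ⟨U, hU, g, hg⟩ := (Additive.toMul (α := cartierSubgroup X) Δ).2 x
  exact ⟨U, hU, g, fun z hz => (hg z hz).symm⟩

/-- One local equation suffices: any other differs from it by a unit of the local ring. -/
lemma mem_stalk_iff {Δ : CartierDivisor X} {x : X} {u : X.functionFieldˣ}
    (hu : (u : X.functionFieldˣ ⧸ stalkUnits X x) = Δ.eqn x) {g : X.functionField} :
    g ∈ Δ.stalk x ↔ g * u ∈ localRing X x := by
  refine ⟨fun h => h u hu, fun h v hv => ?_⟩
  have := (mk_eq_mk_iff.mp (hu.trans hv.symm)).1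
  have h' := mul_mem h this
  rwa [mul_assoc, mul_div_cancel₀ _ u.ne_zero] at h'

variable {Y : Scheme.{u}} [IsIntegral Y] (f : X ⟶ Y) [IsDominant f]

lemma eqn_pullback {Δ : CartierDivisor Y} {x : X} {u : Y.functionFieldˣ}
    (hu : (u : Y.functionFieldˣ ⧸ stalkUnits Y (f x)) = Δ.eqn (f x)) :
    ((Units.map (functionFieldMap f).toMonoidHom u : X.functionFieldˣ) :
      X.functionFieldˣ ⧸ stalkUnits X x) = (Δ.pullback f).eqn x := by
  change _ = QuotientGroup.map _ _ _ _ (Δ.eqn (f x))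
  rw [← hu]
  rfl

lemma pullback_add (Δ Δ' : CartierDivisor Y) :
    (Δ + Δ').pullback f = Δ.pullback f + Δ'.pullback f := by
  refine ext_eqn fun x => ?_
  exact map_mul (QuotientGroup.map (stalkUnits Y (f x)) (stalkUnits X x) _ _) (Δ.eqn (f x)) (Δ'.eqn (f x))

lemma pullback_nsmul (n : ℕ) (Δ : CartierDivisor Y) :
    (n • Δ).pullback f = n • Δ.pullback f := by
  induction n with
  | zero =>
    refine ext_eqn fun x => ?_
    rw [zero_smul, zero_smul]
    exact map_one (QuotientGroup.map (stalkUnits Y (f x)) (stalkUnits X x) _ _)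
  | succ n ih => rw [succ_nsmul, succ_nsmul, pullback_add, ih]

lemma pullback_principalDivisor (g : Y.functionFieldˣ) :
    (principalDivisor g).pullback f =
      principalDivisor (Units.map (functionFieldMap f).toMonoidHom g) := rfl

end CartierDivisor

lemma principalDivisor_mul {X : Scheme.{u}} [IsIntegral X] (g h : X.functionFieldˣ) :
    principalDivisor (g * h) = principalDivisor g + principalDivisor h := rfl

lemma principalDivisor_pow {X : Scheme.{u}} [IsIntegral X] (g : X.functionFieldˣ) (n : ℕ) :
    principalDivisor (g ^ n) = n • principalDivisor g := by
  induction n with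
  | zero => rw [zero_smul, pow_zero]; rfl
  | succ n ih => rw [succ_nsmul, pow_succ, principalDivisor_mul, ih]

lemma principalDivisor_inv {X : Scheme.{u}} [IsIntegral X] (g : X.functionFieldˣ) :
    principalDivisor g⁻¹ = -principalDivisor g := rfl

/-! ### Coefficients in `K[T] / (Tˡ - θ)` -/

section Coordinates

variable {K : Type*} [Field K] {l : ℕ} [NeZero l] {θ : K}

open Polynomial in
/-- The basis `1, T, …, T ^ (l - 1)` of `K[T] / (T ^ l - θ)`. -/
def rootBasis (l : ℕ) [NeZero l] (θ : K) :
    Module.Basis (Fin l) K (AdjoinRoot (X ^ l - C θ : K[X])) :=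
  (AdjoinRoot.powerBasis' (monic_X_pow_sub_C θ (NeZero.ne l))).basis.reindex
    (finCongr (by rw [AdjoinRoot.powerBasis'_dim, natDegree_X_pow_sub_C]))

open Polynomial in
lemma rootBasis_apply (i : Fin l) :
    rootBasis l θ i = AdjoinRoot.root (X ^ l - C θ) ^ (i : ℕ) := by
  simp [rootBasis]

open Polynomial in
/-- The coefficient of `T ^ i`. -/
def rootCoord (i : Fin l) : AdjoinRoot (X ^ l - C θ : K[X]) →ₗ[K] K :=
  (rootBasis l θ).coord i

open Polynomial in
lemma rootCoord_of_mul (i : Fin l) (g : K) (a : AdjoinRoot (X ^ l - C θ : K[X])) :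
    rootCoord i (AdjoinRoot.of _ g * a) = g * rootCoord i a := by
  rw [← AdjoinRoot.algebraMap_eq, ← Algebra.smul_def, map_smul, smul_eq_mul]

open Polynomial in
lemma rootCoord_root_pow (i j : Fin l) :
    rootCoord i (AdjoinRoot.root (X ^ l - C θ) ^ (j : ℕ)) = if j = i then 1 else 0 := by
  rw [← rootBasis_apply, rootCoord, Module.Basis.coord_apply, Module.Basis.repr_self,
    Finsupp.single_apply]

open Polynomial in
lemma rootCoord_sum (i : Fin l) (g : Fin l → K) :
    rootCoord i (∑ j : Fin l, AdjoinRoot.of (X ^ l - C θ) (g j) * AdjoinRoot.root _ ^ (j : ℕ)) =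
      g i := by
  simp [rootCoord_of_mul, rootCoord_root_pow]

open Polynomial in
lemma sum_rootCoord (a : AdjoinRoot (X ^ l - C θ : K[X])) :
    ∑ j : Fin l, AdjoinRoot.of (X ^ l - C θ) (rootCoord j a) * AdjoinRoot.root _ ^ (j : ℕ) = a := by
  conv_rhs => rw [← (rootBasis l θ).sum_repr a]
  refine Finset.sum_congr rfl fun j _ => ?_
  rw [rootBasis_apply, Algebra.smul_def, AdjoinRoot.algebraMap_eq]
  rfl

open Polynomial in
lemma root_pow_eq {K : Type*} [Field K] (l : ℕ) (θ : K) :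
    AdjoinRoot.root (X ^ l - C θ) ^ l = AdjoinRoot.of _ θ := by
  have := AdjoinRoot.eval₂_root (X ^ l - C θ)
  simpa [sub_eq_zero] using this

open Polynomial in
lemma rootCoord_of (i : Fin l) (g : K) :
    rootCoord i (AdjoinRoot.of (X ^ l - C θ) g) = if (i : ℕ) = 0 then g else 0 := by
  have h := rootCoord_of_mul (θ := θ) i g (AdjoinRoot.root _ ^ ((0 : Fin l) : ℕ))
  rw [rootCoord_root_pow, Fin.val_zero, pow_zero, mul_one] at h
  simp only [h, Fin.ext_iff, Fin.val_zero, eq_comm, mul_ite, mul_one, mul_zero]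

open Polynomial in
lemma rootCoord_succ_root_mul (a : AdjoinRoot (X ^ l - C θ : K[X])) (i : ℕ) (hi : i + 1 < l) :
    rootCoord ⟨i + 1, hi⟩ (AdjoinRoot.root _ * a) = rootCoord ⟨i, by omega⟩ a := by
  conv_lhs => rw [← sum_rootCoord a]
  rw [Finset.mul_sum, map_sum, Finset.sum_eq_single ⟨i, by omega⟩]
  · rw [mul_left_comm, rootCoord_of_mul, ← pow_succ',
      rootCoord_root_pow ⟨i + 1, hi⟩ ⟨i + 1, hi⟩, if_pos rfl, mul_one]
  · intro j _ hj
    rw [mul_left_comm, rootCoord_of_mul, ← pow_succ']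
    by_cases h : (j : ℕ) + 1 < l
    · rw [rootCoord_root_pow ⟨i + 1, hi⟩ ⟨j + 1, h⟩, if_neg (fun h' => ?_), mul_zero]
      exact hj (Fin.ext (Nat.succ_injective (congrArg Fin.val h')))
    -- The top power wraps around to the constant `θ`, which does not affect a coefficient of
    -- positive index.
    · rw [show (j : ℕ) + 1 = l by omega, root_pow_eq, rootCoord_of, if_neg (by simp), mul_zero]
  · exact fun h => absurd (Finset.mem_univ _) h

open Polynomial in
lemma rootCoord_zero_root_mul (a : AdjoinRoot (X ^ l - C θ : K[X])) (i : ℕ) (hi : i + 1 = l) :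
    rootCoord 0 (AdjoinRoot.root _ * a) = θ * rootCoord ⟨i, by omega⟩ a := by
  conv_lhs => rw [← sum_rootCoord a]
  rw [Finset.mul_sum, map_sum, Finset.sum_eq_single ⟨i, by omega⟩]
  · rw [mul_left_comm, rootCoord_of_mul, ← pow_succ', hi, root_pow_eq, rootCoord_of,
      if_pos (by simp), mul_comm]
  · intro j _ hj
    rw [mul_left_comm, rootCoord_of_mul, ← pow_succ']
    have hj' : (j : ℕ) ≠ i := fun h' => hj (Fin.ext h')
    have h : (j : ℕ) + 1 < l := by omega
    rw [rootCoord_root_pow 0 ⟨j + 1, h⟩, if_neg (fun h' => ?_), mul_zero]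
    exact absurd (congrArg Fin.val h') (by simp)
  · exact fun h => absurd (Finset.mem_univ _) h

end Coordinates

/-! ### Powers of the radical of `(t)` in the local algebra of the cover -/

section Filtration

/-- The exponent `⌈(n - i) / l⌉` (for `i < l`). -/
def divExp (l n i : ℕ) : ℕ := (n + l - 1 - i) / l

lemma divExp_zero {l i : ℕ} (hi : i < l) : divExp l 0 i = 0 :=
  Nat.div_eq_of_lt (by omega)

lemma divExp_succ_succ (l n i : ℕ) : divExp l (n + 1) (i + 1) = divExp l n i := by
  rw [divExp, divExp]
  congr 1
  omega

lemma divExp_succ_zero {l : ℕ} (n i : ℕ) (hi : i + 1 = l) : divExp l (n + 1) 0 = divExp l n i + 1 := by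
  rw [divExp, divExp, ← Nat.add_div_right _ (by omega)]
  congr 1
  omega

lemma divExp_of_lt {l n q r i : ℕ} (hn : n = q * l + r) (hi : i < r) (hr : r < l) :
    divExp l n i = q + 1 := by
  rw [divExp, hn, Nat.div_eq_iff (by omega)]
  rw [add_mul]
  omega

lemma divExp_of_ge {l n q r i : ℕ} (hn : n = q * l + r) (hi : r ≤ i) (hil : i < l) :
    divExp l n i = q := by
  rw [divExp, hn, Nat.div_eq_iff (by omega)]
  omega

variable {K : Type*} [Field K] {l : ℕ} [NeZero l] {θ : K}

open Polynomial in
/-- The elements `∑ gᵢ Tⁱ` for which `gᵢ` lies in `m⁻ⁱ t ^ ⌈(n - i) / l⌉ R` for all `i < l`. -/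
def IsInFiltration (R : Subring K) (m t : K) (n : ℕ) (a : AdjoinRoot (X ^ l - C θ : K[X])) : Prop :=
  ∀ i : Fin l, rootCoord i a * m ^ (i : ℕ) / t ^ divExp l n i ∈ R

variable {R : Subring K} {m t ε : K}

open Polynomial in
lemma IsInFiltration.of_le (ht : t ∈ R) (ht0 : t ≠ 0) {n : ℕ} {a : AdjoinRoot (X ^ l - C θ : K[X])}
    (h : IsInFiltration R m t n a) : IsInFiltration R m t 0 a := by
  intro i
  have := mul_mem (h i) (pow_mem ht (divExp l n i))
  rwa [div_mul_cancel₀ _ (pow_ne_zero _ ht0), ← div_one (_ * _), ← pow_zero t,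
    ← divExp_zero i.2] at this

open Polynomial in
-- Multiplication by `Z = m⁻¹ T` moves coefficient `i` to `i + 1`, where the exponent `⌈(n - i) /
-- l⌉` is unchanged. The last coefficient returns to index `0` multiplied by `m⁻¹ θ`, which supplies
-- exactly the extra factor `t`, up to the unit `ε` and powers of `m`.
lemma isInFiltration_succ_iff (hm : m ≠ 0) (ht0 : t ≠ 0) (hε : ε ∈ R) (hε' : ε⁻¹ ∈ R)
    (hε0 : ε ≠ 0) (hθ : θ = m ^ l * (ε * t)) (n : ℕ) (a : AdjoinRoot (X ^ l - C θ : K[X])) :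
    IsInFiltration R m t (n + 1) (AdjoinRoot.of _ m⁻¹ * (AdjoinRoot.root _ * a)) ↔
      IsInFiltration R m t n a := by
  obtain ⟨L, rfl⟩ : ∃ L, l = L + 1 := ⟨l - 1, by have := NeZero.pos l; omega⟩
  have hsucc (i : ℕ) (hi : i + 1 < L + 1) :
      rootCoord ⟨i + 1, hi⟩ (AdjoinRoot.of _ m⁻¹ * (AdjoinRoot.root _ * a)) * m ^ (i + 1) /
        t ^ divExp (L + 1) (n + 1) (i + 1) =
      rootCoord ⟨i, by omega⟩ a * m ^ i / t ^ divExp (L + 1) n i := by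
    rw [rootCoord_of_mul, rootCoord_succ_root_mul, divExp_succ_succ]
    generalize rootCoord ⟨i, _⟩ a = g
    field_simp
    ring
  have hzero : rootCoord 0 (AdjoinRoot.of _ m⁻¹ * (AdjoinRoot.root _ * a)) * m ^ 0 /
        t ^ divExp (L + 1) (n + 1) 0 =
      ε * (rootCoord ⟨L, by omega⟩ a * m ^ L / t ^ divExp (L + 1) n L) := by
    rw [rootCoord_of_mul, rootCoord_zero_root_mul a L rfl, divExp_succ_zero n L rfl]
    generalize rootCoord ⟨L, _⟩ a = g
    rw [hθ]
    field_simp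
    ring
  constructor
  · intro h i
    rcases eq_or_ne (i : ℕ) L with hi | hi
    · have := mul_mem hε' (hzero ▸ h 0)
      rw [inv_mul_cancel_left₀ hε0] at this
      exact (show i = ⟨L, by omega⟩ from Fin.ext hi) ▸ this
    · have hi' : (i : ℕ) + 1 < L + 1 := by omega
      exact (hsucc i hi') ▸ h ⟨i + 1, hi'⟩
  · rintro h ⟨_ | i, hi⟩
    · exact hzero.symm ▸ mul_mem hε (h ⟨L, by omega⟩)
    · exact (hsucc i hi).symm ▸ h ⟨i, by omega⟩

variable {A : Type*} [CommRing A]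

open Polynomial in
/-- In the algebra `⨁_{i < l} R Zⁱ` with `Z = m⁻¹ T` and `Zˡ = ε t`, the powers of the radical of
`(t)` are the steps of the filtration, provided that `tR` is a radical ideal of `R`. -/
lemma mem_pow_radical_iff (φ : A →+* AdjoinRoot (X ^ l - C θ : K[X]))
    (hφ : Function.Injective φ) (hrange : ∀ a, a ∈ φ.range ↔ IsInFiltration R m t 0 a)
    (hm : m ≠ 0) (ht : t ∈ R) (ht0 : t ≠ 0) (hε : ε ∈ R) (hε' : ε⁻¹ ∈ R) (hε0 : ε ≠ 0)
    (hθ : θ = m ^ l * (ε * t)) (hrad : ∀ x ∈ R, ∀ N : ℕ, x ^ N / t ∈ R → x / t ∈ R)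
    {τ : A} (hτ : φ τ = AdjoinRoot.of _ t) (n : ℕ) (x : A) :
    x ∈ (Ideal.span {τ}).radical ^ n ↔ IsInFiltration R m t n (φ x) := by
  have hdiv0 (i : Fin l) : t ^ divExp l 0 i = 1 := by rw [divExp_zero i.2, pow_zero]
  have hof (g : K) (hg : g ∈ R) : AdjoinRoot.of _ g ∈ φ.range := by
    rw [hrange]
    intro i
    rw [rootCoord_of, hdiv0, div_one]
    split_ifs with h
    · rwa [h, pow_zero, mul_one]
    · rw [zero_mul]; exact zero_mem _
  -- `z` is the element `Z`; it lies in the image of `A` because `Z * 1` is in step `1` of the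
  -- filtration.
  obtain ⟨z, hz⟩ : AdjoinRoot.of _ m⁻¹ * (AdjoinRoot.root _ * 1) ∈ φ.range := by
    rw [hrange]
    refine IsInFiltration.of_le ht ht0 (n := 1) ?_
    rw [isInFiltration_succ_iff hm ht0 hε hε' hε0 hθ, ← hrange]
    exact one_mem _
  rw [mul_one] at hz
  -- `Z` is invertible over `K` since `Tˡ = θ ≠ 0`. This permits division by `Z` below; the
  -- filtration then shows that the quotient lies in `A`.
  have hroot : IsUnit (AdjoinRoot.of _ m⁻¹ * AdjoinRoot.root (X ^ l - C θ)) := by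
    refine IsUnit.mul ((IsUnit.mk0 _ (inv_ne_zero hm)).map _) ?_
    rw [← isUnit_pow_iff (NeZero.ne l), root_pow_eq]
    refine IsUnit.map _ (IsUnit.mk0 _ ?_)
    rw [hθ]
    exact mul_ne_zero (pow_ne_zero _ hm) (mul_ne_zero hε0 ht0)
  have hspan (n : ℕ) (x : A) : x ∈ Ideal.span {z} ^ n ↔ IsInFiltration R m t n (φ x) := by
    rw [Ideal.span_singleton_pow, Ideal.mem_span_singleton]
    induction n generalizing x with
    | zero => simp [← hrange]
    | succ n ih =>
      constructor
      · rintro ⟨y, rfl⟩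
        rw [pow_succ', mul_assoc, map_mul, hz, mul_assoc,
          isInFiltration_succ_iff hm ht0 hε hε' hε0 hθ, ← ih]
        exact dvd_mul_right _ _
      · intro h
        obtain ⟨b, hb⟩ := hroot.dvd (a := φ x)
        rw [hb, mul_assoc, isInFiltration_succ_iff hm ht0 hε hε' hε0 hθ] at h
        obtain ⟨y, rfl⟩ := (hrange b).mpr (h.of_le ht ht0)
        rw [← hz, ← map_mul] at hb
        rw [hφ hb, pow_succ']
        exact mul_dvd_mul_left z ((ih y).mpr h)
  have hz_pow : z ^ l ∣ τ ∧ τ ∣ z ^ l := by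
    obtain ⟨e, he⟩ := hof ε hε
    obtain ⟨e', he'⟩ := hof _ hε'
    have hzl : φ (z ^ l) = AdjoinRoot.of _ (ε * t) := by
      rw [map_pow, hz, mul_pow, root_pow_eq, ← map_pow, ← map_mul, hθ, inv_pow,
        inv_mul_cancel_left₀ (pow_ne_zero _ hm)]
    refine ⟨⟨e', hφ ?_⟩, ⟨e, hφ ?_⟩⟩
    · rw [map_mul, hzl, hτ, he', ← map_mul]
      congr 1
      field_simp
    · rw [map_mul, hzl, hτ, he, ← map_mul, mul_comm]
  have hmem_one (x : A) : z ∣ x ↔ IsInFiltration R m t 1 (φ x) := by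
    rw [← hspan, pow_one, Ideal.mem_span_singleton]
  -- In step `1` only the constant coefficient is constrained, as `⌈(1 - i) / l⌉ = 0` for `0 < i <
  -- l`.
  have hone (x : A) : z ∣ x ↔ rootCoord 0 (φ x) / t ∈ R := by
    have hl := NeZero.pos l
    have hexp : divExp l 1 0 = 1 := by
      rw [divExp, show 1 + l - 1 - 0 = l by omega, Nat.div_self hl]
    rw [hmem_one]
    refine ⟨fun h => ?_, fun h i => ?_⟩
    · have := h 0
      rwa [Fin.val_zero, hexp, pow_zero, pow_one, mul_one] at this
    · by_cases hi : i = 0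
      · rwa [hi, Fin.val_zero, hexp, pow_zero, pow_one, mul_one]
      · have hi' : divExp l 1 i = 0 :=
          Nat.div_eq_of_lt (by have := Fin.val_ne_zero_iff.mpr hi; omega)
        have := (hrange (φ x)).mp ⟨x, rfl⟩ i
        rw [hdiv0] at this
        rwa [hi', pow_zero]
  -- Modulo `Z` an element `x` equals its constant coefficient `ρ ∈ R`. If `x ^ N` is divisible by
  -- `t`, then `Z` divides `ρ ^ N`, so `t` divides `ρ ^ N` in `R`, hence `t` divides `ρ` by
  -- radicality.
  have hrad' : (Ideal.span {τ}).radical = Ideal.span {z} := by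
    refine le_antisymm (fun x hx => ?_) ?_
    · obtain ⟨N, hN⟩ := hx
      rw [Ideal.mem_span_singleton] at hN ⊢
      have hzN : z ∣ x ^ N := ((dvd_pow_self z (NeZero.ne l)).trans hz_pow.1).trans hN
      have hr : rootCoord 0 (φ x) ∈ R := by
        have := (hrange (φ x)).mp ⟨x, rfl⟩ 0
        rwa [hdiv0, div_one, Fin.val_zero, pow_zero, mul_one] at this
      obtain ⟨ρ, hρ⟩ := hof _ hr
      have hxρ : z ∣ x - ρ := by
        rw [hone, map_sub, map_sub, hρ, rootCoord_of, if_pos (by simp), sub_self, zero_div]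
        exact zero_mem _
      have hρN : z ∣ ρ ^ N := by
        have := dvd_sub hzN (hxρ.trans (sub_dvd_pow_sub_pow x ρ N))
        rwa [sub_sub_cancel] at this
      have hzρ : z ∣ ρ := by
        rw [hone, hρ, rootCoord_of, if_pos (by simp)]
        refine hrad _ hr N ?_
        rwa [hone, map_pow, hρ, ← map_pow, rootCoord_of, if_pos (by simp)] at hρN
      have := dvd_add hxρ hzρ
      rwa [sub_add_cancel] at this
    · rw [Ideal.span_singleton_le_iff_mem]
      exact ⟨l, Ideal.mem_span_singleton.mpr hz_pow.2⟩
  rw [hrad', hspan]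

end Filtration

/-! ### Transcendental elements and the two charts of the projective line -/

section Polynomials

open Polynomial

variable {K F : Type*} [Field K] [Field F] (φ : K →+* F)

lemma exists_eval₂_of_mem_closure (R : Subring K) (z g : F)
    (hg : g ∈ Subring.closure (φ '' (R : Set K) ∪ {z})) :
    ∃ Q : R[X], Q.eval₂ (φ.comp R.subtype) z = g := by
  suffices h : Subring.closure (φ '' (R : Set K) ∪ {z}) ≤
      (eval₂RingHom (φ.comp R.subtype) z).range from h hg
  rw [Subring.closure_le]
  rintro _ (⟨r, hr, rfl⟩ | rfl)
  · exact ⟨C ⟨r, hr⟩, by simp⟩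
  · exact ⟨X, by simp⟩

/-- `R[z] ∩ R[z⁻¹] = R` for a transcendental `z`. -/
lemma exists_of_mem_closure_of_mem_closure_inv (R : Subring K) {z g : F}
    (hz : ∀ Q : K[X], Q.eval₂ φ z = 0 → Q = 0)
    (h₁ : g ∈ Subring.closure (φ '' (R : Set K) ∪ {z}))
    (h₂ : g ∈ Subring.closure (φ '' (R : Set K) ∪ {z⁻¹})) : ∃ c ∈ R, φ c = g := by
  obtain ⟨Q₁, hQ₁⟩ := exists_eval₂_of_mem_closure φ R z g h₁
  obtain ⟨Q₂, hQ₂⟩ := exists_eval₂_of_mem_closure φ R z⁻¹ g h₂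
  have hz0 : z ≠ 0 := fun h => X_ne_zero (hz X (by simp [h]))
  have hz' (Q : R[X]) (h : Q.eval₂ (φ.comp R.subtype) z = 0) : Q = 0 := by
    rw [← eval₂_map] at h
    exact (Polynomial.map_eq_zero_iff R.subtype_injective).mp (hz _ h)
  let _ : Invertible z⁻¹ := invertibleOfNonzero (inv_ne_zero hz0)
  have hrev := eval₂_reverse_mul_pow (φ.comp R.subtype) z⁻¹ Q₂
  rw [invOf_eq_inv, inv_inv, hQ₂, ← hQ₁] at hrev
  -- With `d = deg Q₂`, clearing denominators in `Q₁(z) = Q₂(z⁻¹)` gives `Q₁ Xᵈ = reverse Q₂`. The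
  -- right side has degree at most `d`, so `Q₁` is constant.
  have heq : Q₁ * X ^ Q₂.natDegree = Q₂.reverse := by
    rw [← sub_eq_zero]
    apply hz'
    rw [eval₂_sub, eval₂_mul, eval₂_X_pow, ← hrev, mul_assoc, ← mul_pow, inv_mul_cancel₀ hz0,
      one_pow, mul_one, sub_self]
  have hdeg : Q₁.natDegree = 0 := by
    by_cases h0 : Q₁ = 0
    · rw [h0, natDegree_zero]
    have h1 := natDegree_mul_X_pow Q₂.natDegree h0
    have h2 := Q₂.reverse_natDegree_le
    rw [← heq] at h2
    omega
  rw [eq_C_of_natDegree_eq_zero hdeg, eval₂_C] at hQ₁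
  exact ⟨_, (Q₁.coeff 0).2, hQ₁⟩

lemma eval₂_affine_eq_zero {y : F} (hy : ∀ Q : K[X], Q.eval₂ φ y = 0 → Q = 0) {a b : K}
    (hb : b ≠ 0) (Q : K[X]) (h : Q.eval₂ φ (φ a + φ b * y) = 0) : Q = 0 := by
  have h1 : (Q.comp (C a + C b * X)).eval₂ φ y = 0 := by
    rw [eval₂_comp]
    simpa using h
  have h2 := hy _ h1
  rw [comp_eq_zero_iff] at h2
  refine h2.resolve_right fun h3 => hb ?_
  have := congrArg (fun q => q.coeff 1) h3.2
  simpa using this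

end Polynomials

lemma exists_affineOpens_le {X : Scheme.{u}} {x : X} {U : X.Opens} (hx : x ∈ U) :
    ∃ V : X.affineOpens, x ∈ (V : X.Opens) ∧ (V : X.Opens) ≤ U := by
  obtain ⟨_, ⟨V, hV, rfl⟩, hxV, hVU⟩ := X.isBasis_affineOpens.exists_subset_of_mem_open hx U.isOpen
  exact ⟨⟨V, hV⟩, hxV, hVU⟩

/-! ### Local frames of the extension `ℰ` -/

section Extension

variable {C : Scheme.{u}} [IsIntegral C] {D : CartierDivisor C} {e : C → C.functionField}

lemma one_zero_mem_extensionStalk (x : C) : (1, 0) ∈ extensionStalk D e x :=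
  ⟨zero_mem _, by simp⟩

lemma frame_mem_extensionStalk {x : C} {u : C.functionFieldˣ}
    (hu : (u : C.functionFieldˣ ⧸ stalkUnits C x) = D.eqn x) {e₀ : C.functionField}
    (he : e₀ - e x ∈ (-D).stalk x) :
    (e₀ * ((u⁻¹ : C.functionFieldˣ) : C.functionField), ((u⁻¹ : C.functionFieldˣ) : C.functionField)) ∈
      extensionStalk D e x := by
  refine ⟨?_, ?_⟩
  · rw [CartierDivisor.mem_stalk_iff hu, Units.inv_mul]
    exact one_mem _
  · have hu' : ((u⁻¹ : C.functionFieldˣ) : C.functionFieldˣ ⧸ stalkUnits C x) = (-D).eqn x := by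
      rw [CartierDivisor.eqn_neg, ← hu]; rfl
    rw [CartierDivisor.mem_stalk_iff hu'] at he
    rwa [← sub_mul]

/-- The condition defining `ℰ_x` depends on `e x` only modulo `𝒪_C(-D)_x`, because the second
component lies in `𝒪_C(D)_x`. -/
lemma sub_mul_mem_localRing {x : C} {u : C.functionFieldˣ}
    (hu : (u : C.functionFieldˣ ⧸ stalkUnits C x) = D.eqn x) {e₀ : C.functionField}
    (he : e₀ - e x ∈ (-D).stalk x) {s : C.functionField × C.functionField}
    (hs : s ∈ extensionStalk D e x) : s.1 - e₀ * s.2 ∈ localRing C x := by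
  have hu' : ((u⁻¹ : C.functionFieldˣ) : C.functionFieldˣ ⧸ stalkUnits C x) = (-D).eqn x := by
    rw [CartierDivisor.eqn_neg, ← hu]; rfl
  rw [CartierDivisor.mem_stalk_iff hu'] at he
  have h1 := (CartierDivisor.mem_stalk_iff hu).mp hs.1
  have h2 := sub_mem hs.2 (mul_mem he h1)
  convert h2 using 1
  have := u.ne_zero
  rw [Units.val_inv_eq_inv_val]
  field_simp
  ring

/-- Over an open set on which `D` has the local equation `u` and the cocycle `e₀ - e_x` takes values
in `𝒪_C(-D)`, the extension is free with basis `(1, 0)` and `(e₀ u⁻¹, u⁻¹)`. -/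
lemma exists_basis_extensionSections {U : C.Opens} [Nonempty U] {u : C.functionFieldˣ}
    (hu : ∀ x ∈ U, (u : C.functionFieldˣ ⧸ stalkUnits C x) = D.eqn x) {e₀ : C.functionField}
    (he : ∀ x ∈ U, e₀ - e x ∈ (-D).stalk x) :
    ∃ b : Module.Basis (Fin 2) Γ(C, U) (extensionSections D e U),
      (b 0).1 = (1, 0) ∧ (b 1).1 = (e₀ * ((u⁻¹ : C.functionFieldˣ) : C.functionField),
        ((u⁻¹ : C.functionFieldˣ) : C.functionField)) := by
  let b₀ : extensionSections D e U := ⟨(1, 0), fun x _ => one_zero_mem_extensionStalk x⟩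
  let b₁ : extensionSections D e U := ⟨(e₀ * ((u⁻¹ : C.functionFieldˣ) : C.functionField),
        ((u⁻¹ : C.functionFieldˣ) : C.functionField)),
    fun x hx => frame_mem_extensionStalk (hu x hx) (he x hx)⟩
  have hinj := C.germToFunctionField_injective U
  have hsmul (r : Γ(C, U)) (a : C.functionField) : r • a = C.germToFunctionField U r * a :=
    Algebra.smul_def r a
  have hli : LinearIndependent Γ(C, U) ![b₀, b₁] := by
    rw [LinearIndependent.pair_iff]
    intro r s h
    have h' : r • b₀.1 + s • b₁.1 = 0 := congrArg Subtype.val h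
    have h2 : C.germToFunctionField U s = 0 := by
      have := congrArg Prod.snd h'
      simpa [b₀, b₁, hsmul] using this
    have h1 : C.germToFunctionField U r = 0 := by
      have := congrArg Prod.fst h'
      simpa [b₀, b₁, hsmul, h2] using this
    exact ⟨(map_eq_zero_iff _ hinj).mp h1, (map_eq_zero_iff _ hinj).mp h2⟩
  have hspan : ⊤ ≤ Submodule.span Γ(C, U) (Set.range ![b₀, b₁]) := by
    rintro a -
    obtain ⟨s, hs⟩ := exists_section_of_forall_mem_localRing U (a.1.2 * u)
      fun x hx => (CartierDivisor.mem_stalk_iff (hu x hx)).mp (a.2 x hx).1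
    obtain ⟨r, hr⟩ := exists_section_of_forall_mem_localRing U (a.1.1 - e₀ * a.1.2)
      fun x hx => sub_mul_mem_localRing (hu x hx) (he x hx) (a.2 x hx)
    rw [Matrix.range_cons, Matrix.range_cons, Matrix.range_empty, Set.union_empty,
      Set.singleton_union, Submodule.mem_span_pair]
    refine ⟨r, s, Subtype.ext ?_⟩
    change r • b₀.1 + s • b₁.1 = a.1
    have := u.ne_zero
    refine Prod.ext ?_ ?_
    · change r • (1 : C.functionField) + s • (e₀ * ((u⁻¹ : C.functionFieldˣ) : C.functionField)) = _
      rw [hsmul, hsmul, hr, hs, Units.val_inv_eq_inv_val]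
      field_simp
      ring
    · change r • (0 : C.functionField) + s • ((u⁻¹ : C.functionFieldˣ) : C.functionField) = _
      rw [hsmul, hsmul, hs, Units.val_inv_eq_inv_val]
      field_simp
      ring
  refine ⟨Module.Basis.mk hli hspan, ?_, ?_⟩
  · rw [Module.Basis.mk_apply]; rfl
  · rw [Module.Basis.mk_apply]; rfl

end Extension

/-! ### Global functions on the ruled surface -/

section GlobalFunctions

variable {C P : Scheme.{u}} [IsIntegral C] [IsIntegral P] (π : P ⟶ C) [IsDominant π]
  {D : CartierDivisor C} {e : C → C.functionField} {y : P.functionField}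

lemma linearForm_one_zero : linearForm π y (1, 0) = 1 := by
  simp [linearForm]

variable {π}

lemma IsProjectiveBundle.linearForm_ne_zero (hP : IsProjectiveBundle π D e y)
    {s : C.functionField × C.functionField} (hs : s.2 ≠ 0) : linearForm π y s ≠ 0 := fun h =>
  Polynomial.X_ne_zero (eval₂_affine_eq_zero (functionFieldMap π) hP.transcendental hs Polynomial.X
    (by rwa [Polynomial.eval₂_X]))

/-- `π_* 𝒪_P = 𝒪_C` on global sections. -/
lemma IsProjectiveBundle.exists_eq_functionFieldMap (hP : IsProjectiveBundle π D e y)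
    (hcoh : ∀ x, ∃ U : C.Opens, x ∈ U ∧ ∀ z ∈ U, e x - e z ∈ (-D).stalk z)
    {g : P.functionField} (hg : ∀ w, g ∈ localRing P w) :
    ∃ a : C.functionField, functionFieldMap π a = g ∧ ∀ x, a ∈ localRing C x := by
  have hloc (x : C) : ∃ a ∈ localRing C x, functionFieldMap π a = g := by
    obtain ⟨U₁, hx₁, he⟩ := hcoh x
    obtain ⟨U₂, hx₂, u, hu⟩ := D.exists_eqn x
    obtain ⟨⟨U, hU⟩, hxU, hle⟩ := exists_affineOpens_le (U := U₁ ⊓ U₂) ⟨hx₁, hx₂⟩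
    have : Nonempty U := ⟨⟨x, hxU⟩⟩
    obtain ⟨b, hb₀, hb₁⟩ := exists_basis_extensionSections (D := D) (e := e) (U := U)
      (fun z hz => hu z (hle hz).2) (fun z hz => he z (hle hz).1)
    obtain ⟨V, W, _, _, -, -, -, hV, hW⟩ := hP.charts U hU b
    -- In this frame the two charts have coordinate rings `R[z]` and `R[z⁻¹]`, where `z` is the
    -- linear form of the second basis vector; it is transcendental because its coefficient `u⁻¹` of
    -- `y` is nonzero.
    rw [IsChart, hb₀, hb₁, linearForm_one_zero, div_one] at hV
    rw [IsChart, hb₀, hb₁, linearForm_one_zero, one_div] at hW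
    obtain ⟨s, hs⟩ := exists_section_of_forall_mem_localRing V g fun w _ => hg w
    obtain ⟨t, ht⟩ := exists_section_of_forall_mem_localRing W g fun w _ => hg w
    have h1 : g ∈ (P.germToFunctionField V).hom.range := ⟨s, hs⟩
    have h2 : g ∈ (P.germToFunctionField W).hom.range := ⟨t, ht⟩
    rw [hV] at h1
    rw [hW] at h2
    obtain ⟨_, ⟨r, rfl⟩, hr⟩ := exists_of_mem_closure_of_mem_closure_inv (functionFieldMap π)
      (C.germToFunctionField U).hom.range
      (fun Q hQ => eval₂_affine_eq_zero (functionFieldMap π) hP.transcendental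
        (Units.ne_zero u⁻¹) Q hQ) h1 h2
    exact ⟨_, germToFunctionField_mem_localRing hxU r, hr⟩
  choose a ha ha' using hloc
  -- The local preimages all agree, since the embedding of function fields is injective; the base
  -- point is immaterial.
  refine ⟨a (genericPoint C), ha' _, fun x => ?_⟩
  have : a (genericPoint C) = a x := (functionFieldMap π).injective ((ha' _).trans (ha' x).symm)
  exact this ▸ ha x

/-- The global sections of a proper integral `k`-scheme form a field. The function `0` causes no
exception because `0⁻¹ = 0`. -/
lemma inv_mem_localRing_of_forall_mem {k : Type u} [Field k] (c : C ⟶ Spec (.of k)) [IsProper c]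
    {a : C.functionField} (ha : ∀ x, a ∈ localRing C x) (x : C) : a⁻¹ ∈ localRing C x := by
  have : Nonempty (⊤ : C.Opens) := ⟨⟨x, Opens.mem_top x⟩⟩
  obtain ⟨s, rfl⟩ := exists_section_of_forall_mem_localRing ⊤ a fun x _ => ha x
  by_cases hs : s = 0
  · rw [hs, map_zero, inv_zero]
    exact zero_mem _
  obtain ⟨t, hst⟩ := (isField_of_universallyClosed k c).mul_inv_cancel hs
  have h := congrArg (C.germToFunctionField ⊤) hst
  rw [map_mul, map_one] at h
  rw [inv_eq_of_mul_eq_one_right h]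
  exact germToFunctionField_mem_localRing (U := ⊤) (Opens.mem_top x) t

lemma IsProjectiveBundle.inv_mem_localRing (hP : IsProjectiveBundle π D e y)
    (hcoh : ∀ x, ∃ U : C.Opens, x ∈ U ∧ ∀ z ∈ U, e x - e z ∈ (-D).stalk z)
    {k : Type u} [Field k] (c : C ⟶ Spec (.of k)) [IsProper c]
    {g : P.functionField} (hg : ∀ w, g ∈ localRing P w) (w : P) : g⁻¹ ∈ localRing P w := by
  obtain ⟨a, rfl, ha⟩ := hP.exists_eq_functionFieldMap hcoh hg
  rw [← map_inv₀]
  exact functionFieldMap_mem_localRing π (inv_mem_localRing_of_forall_mem c ha _)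

end GlobalFunctions

/-! ### The section: its divisor, and its disjointness from the multisection -/

section QuotientSection

variable {C P : Scheme.{u}} [IsIntegral C] [IsIntegral P] {π : P ⟶ C} [IsDominant π]
  {D : CartierDivisor C} {e : C → C.functionField} {y : P.functionField} {σ : C ⟶ P}

lemma IsQuotientSection.apply_eq (hσ : IsQuotientSection π D e y σ) (x : C) : π (σ x) = x := by
  rw [← Scheme.Hom.comp_apply, hσ.comp_eq]
  rfl

/-- The linear form `(e_x u⁻¹, u⁻¹)`, where `u` is a local equation of `D` at `x`, generates
`𝒪_P(1)` at `σ x`. -/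
lemma IsQuotientSection.linearForm_generates (hσ : IsQuotientSection π D e y σ)
    {x : C} {u : C.functionFieldˣ} (hu : (u : C.functionFieldˣ ⧸ stalkUnits C x) = D.eqn x)
    {s : C.functionField × C.functionField} (hs : s ∈ extensionStalk D e x) :
    ∃ g : P.presheaf.stalk (σ x), algebraMap _ P.functionField g =
        linearForm π y s / linearForm π y (e x * ((u⁻¹ : C.functionFieldˣ) : C.functionField),
          ((u⁻¹ : C.functionFieldˣ) : C.functionField)) ∧
      algebraMap _ C.functionField (σ.stalkMap x g) =
        s.2 / ((u⁻¹ : C.functionFieldˣ) : C.functionField) := by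
  refine hσ.pullback_eq x s hs _
    (frame_mem_extensionStalk hu (by rw [sub_self]; exact zero_mem _)) ?_
  refine le_antisymm (fun g hg => ?_) ?_
  · rw [CartierDivisor.mem_stalk_iff hu] at hg
    obtain ⟨a, ha⟩ := hg
    rw [Submodule.mem_span_singleton]
    refine ⟨a, ?_⟩
    rw [Algebra.smul_def, ha, mul_assoc, Units.mul_inv, mul_one]
  · rw [Submodule.span_singleton_le_iff_mem, CartierDivisor.mem_stalk_iff hu, Units.inv_mul]
    exact one_mem _

variable {H : CartierDivisor P}

/-- Along the section, the inverse of the generating linear form is a local equation of the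
tautological divisor, and it vanishes on the section. -/
lemma IsTautologicalDivisor.exists_eqn_vanishing (hH : IsTautologicalDivisor π D e y H)
    (hσ : IsQuotientSection π D e y σ) {x : C} {u : C.functionFieldˣ}
    (hu : (u : C.functionFieldˣ ⧸ stalkUnits C x) = D.eqn x) {L : P.functionFieldˣ}
    (hL : (L : P.functionField) = linearForm π y
      (e x * ((u⁻¹ : C.functionFieldˣ) : C.functionField),
        ((u⁻¹ : C.functionFieldˣ) : C.functionField))) :
    ((L⁻¹ : P.functionFieldˣ) : P.functionFieldˣ ⧸ stalkUnits P (σ x)) = H.eqn (σ x) ∧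
      ∃ g : P.presheaf.stalk (σ x), algebraMap _ P.functionField g =
        ((L⁻¹ : P.functionFieldˣ) : P.functionField) ∧ σ.stalkMap x g = 0 := by
  have hgen := fun s hs => hσ.linearForm_generates hu (s := s) hs
  rw [← hL] at hgen
  constructor
  · obtain ⟨U, hU, a, ha⟩ := H.exists_eqn (σ x)
    rw [← ha _ hU, mk_eq_mk_iff]
    have hst := hH (σ x)
    rw [hσ.apply_eq] at hst
    have hle : ∀ g ∈ H.stalk (σ x), g / L ∈ localRing P (σ x) := by
      intro g hg
      rw [hst] at hg
      induction hg using Submodule.span_induction with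
      | mem g hg =>
        obtain ⟨s, hs, rfl⟩ := hg
        obtain ⟨b, hb, -⟩ := hgen s hs
        exact ⟨b, hb⟩
      | zero => rw [zero_div]; exact zero_mem _
      | add g h _ _ hg hh => rw [add_div]; exact add_mem hg hh
      | smul c g _ hg =>
        rw [Algebra.smul_def, mul_div_assoc]
        exact mul_mem ⟨c, rfl⟩ hg
    have h1 : (L : P.functionField) ∈ H.stalk (σ x) := by
      rw [hst, hL]
      exact Submodule.subset_span ⟨_, frame_mem_extensionStalk hu
        (by rw [sub_self]; exact zero_mem _), rfl⟩
    have h2 := hle ((a⁻¹ : P.functionFieldˣ) : P.functionField) (by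
      rw [CartierDivisor.mem_stalk_iff (ha _ hU), Units.inv_mul]
      exact one_mem _)
    rw [CartierDivisor.mem_stalk_iff (ha _ hU)] at h1
    simp only [Units.val_inv_eq_inv_val] at h2 ⊢
    constructor
    · rwa [div_inv_eq_mul, mul_comm]
    · rwa [div_eq_mul_inv, mul_comm, ← div_eq_mul_inv]
  -- `(1, 0)` is the image of `1 ∈ 𝒪_C` and dies in the quotient `L`; so `X / L`, which is `L⁻¹` in
  -- the trivialization by `X`, pulls back to `0`.
  · obtain ⟨g, hg, hg'⟩ := hgen (1, 0) (one_zero_mem_extensionStalk x)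
    refine ⟨g, ?_, ?_⟩
    · rw [hg, linearForm_one_zero, one_div, Units.val_inv_eq_inv_val]
    · rw [zero_div] at hg'
      exact (map_eq_zero_iff _ (IsFractionRing.injective (C.presheaf.stalk x) C.functionField)).mp hg'

/-- The section `X` of `𝒪_P(1)` becomes `1` in its own trivialization. Once `E = H` is known, this
is the effectivity of `E`. -/
lemma IsTautologicalDivisor.one_mem_stalk (hH : IsTautologicalDivisor π D e y H) (w : P) :
    1 ∈ H.stalk w := by
  rw [hH w, ← linearForm_one_zero π (y := y)]
  exact Submodule.subset_span ⟨_, one_zero_mem_extensionStalk _, rfl⟩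

lemma exists_linearForm_unit (hP : IsProjectiveBundle π D e y) (x : C) (u : C.functionFieldˣ) :
    ∃ L : P.functionFieldˣ, (L : P.functionField) = linearForm π y
      (e x * ((u⁻¹ : C.functionFieldˣ) : C.functionField),
        ((u⁻¹ : C.functionFieldˣ) : C.functionField)) :=
  ⟨Units.mk0 _ (hP.linearForm_ne_zero (Units.ne_zero u⁻¹)), rfl⟩

/-- The local equations of the tautological divisor vanish on the section. -/
lemma IsTautologicalDivisor.app_eq_zero (hP : IsProjectiveBundle π D e y)
    (hH : IsTautologicalDivisor π D e y H) (hσ : IsQuotientSection π D e y σ)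
    {U : P.Opens} [Nonempty U] {a : P.functionFieldˣ}
    (ha : ∀ w ∈ U, (a : P.functionFieldˣ ⧸ stalkUnits P w) = H.eqn w) {s : Γ(P, U)}
    (hs : P.germToFunctionField U s = a) : σ.app U s = 0 := by
  refine TopCat.Presheaf.section_ext C.sheaf (σ ⁻¹ᵁ U) _ _ fun x hx => ?_
  obtain ⟨V, hxV, u, hu⟩ := D.exists_eqn x
  obtain ⟨L, hL⟩ := exists_linearForm_unit hP (e := e) x u
  obtain ⟨hLH, g, hg, hg'⟩ := hH.exists_eqn_vanishing hσ (hu x hxV) hL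
  have hmk := (mk_eq_mk_iff.mp (hLH.trans (ha (σ x) hx).symm)).1
  obtain ⟨b, hb⟩ := hmk
  have hx' : σ x ∈ U := hx
  have heq : P.presheaf.germ U (σ x) hx' s = b * g := by
    apply IsFractionRing.injective (P.presheaf.stalk (σ x)) P.functionField
    rw [Scheme.algebraMap_germ_eq_germToFunctionField, hs, map_mul, hb, hg]
    have := L.ne_zero
    rw [Units.val_inv_eq_inv_val]
    field_simp
  have h := Scheme.Hom.germ_stalkMap_apply σ U x hx s
  rw [heq, map_mul, hg', mul_zero] at h
  exact h.symm.trans (map_zero _).symm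

/-- A section of a separated morphism is a closed immersion. -/
lemma IsQuotientSection.isClosedImmersion (hP : IsProjectiveBundle π D e y)
    (hσ : IsQuotientSection π D e y σ) : IsClosedImmersion σ := by
  have := hP.isSeparated
  have : IsClosedImmersion (σ ≫ π) := by rw [hσ.comp_eq]; infer_instance
  exact IsClosedImmersion.of_comp σ π

/-- If the divisor of the section is linearly equivalent to the tautological divisor, it is equal
to it. -/
lemma eq_of_isDivisorOf_ker (hP : IsProjectiveBundle π D e y)
    (hcoh : ∀ x, ∃ U : C.Opens, x ∈ U ∧ ∀ z ∈ U, e x - e z ∈ (-D).stalk z)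
    {k : Type u} [Field k] (c : C ⟶ Spec (.of k)) [IsProper c]
    (hH : IsTautologicalDivisor π D e y H) (hσ : IsQuotientSection π D e y σ)
    {E : CartierDivisor P} (hE : E.IsDivisorOf σ.ker) {h : P.functionFieldˣ}
    (hEH : E = H + principalDivisor h) : E = H := by
  have := hσ.isClosedImmersion hP
  -- A local equation `a` of `H` lies in the ideal of the section, that is in `𝒪_P(-E)`. As `a h` is
  -- a local equation of `E`, the quotient `a / (a h) = h⁻¹` is regular.
  have hinv : ∀ w, ((h⁻¹ : P.functionFieldˣ) : P.functionField) ∈ localRing P w := by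
    intro w
    obtain ⟨V, hwV, a, ha⟩ := H.exists_eqn w
    obtain ⟨U, hwU, hUV⟩ := exists_affineOpens_le hwV
    have : Nonempty (U : P.Opens) := ⟨⟨w, hwU⟩⟩
    obtain ⟨s, hs⟩ := exists_section_of_forall_mem_localRing (U : P.Opens) (a : P.functionField)
      fun z hz => by
        simpa using (CartierDivisor.mem_stalk_iff (ha z (hUV hz))).mp (hH.one_mem_stalk z)
    have hker : s ∈ σ.ker.ideal U := by
      rw [Scheme.Hom.ker_apply]
      exact hH.app_eq_zero hP hσ (fun z hz => ha z (hUV hz)) hs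
    have h1 := (hE U s).mp hker w hwU
    have heqn : (((a * h)⁻¹ : P.functionFieldˣ) : P.functionFieldˣ ⧸ stalkUnits P w) =
        (-E).eqn w := by
      rw [hEH, CartierDivisor.eqn_neg, CartierDivisor.eqn_add, ← ha w hwV]
      rfl
    rw [CartierDivisor.mem_stalk_iff heqn, hs, mul_inv, Units.val_mul, Units.mul_inv_cancel_left] at h1
    exact h1
  have hprin : principalDivisor h = 0 := by
    refine CartierDivisor.ext_eqn fun w => ?_
    refine (QuotientGroup.eq_one_iff h).mpr (mem_stalkUnits_iff.mpr ⟨?_, hinv w⟩)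
    have := hP.inv_mem_localRing hcoh c hinv w
    rwa [Units.val_inv_eq_inv_val, inv_inv] at this
  rw [hEH, hprin, add_zero]

/-- The multisection is disjoint from the section. -/
lemma eqn_multisection_eq_one (hP : IsProjectiveBundle π D e y) {p : ℕ} [Fact p.Prime]
    [CharP P.functionField p] {f : C.functionField}
    (hlift : ∀ x, f - e x ^ p ∈ (-(p • D)).stalk x)
    (hH : IsTautologicalDivisor π D e y H) (hσ : IsQuotientSection π D e y σ)
    {τ : P.functionFieldˣ} (hτ : (τ : P.functionField) = functionFieldMap π f + y ^ p) (x : C) :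
    (multisection π p D H τ).eqn (σ x) = 1 := by
  obtain ⟨V, hxV, u, hu⟩ := D.exists_eqn x
  replace hu := hu x hxV
  obtain ⟨L, hL⟩ := exists_linearForm_unit hP (e := e) x u
  obtain ⟨hLH, g, hg, hg'⟩ := hH.exists_eqn_vanishing hσ hu hL
  -- The quotient group depends on the point, so the equality `π (σ x) = x` is used by substitution
  -- for a variable point.
  have huπ : (u : C.functionFieldˣ ⧸ stalkUnits C (π (σ x))) = D.eqn (π (σ x)) := by
    have : ∀ x', x' = x → (u : C.functionFieldˣ ⧸ stalkUnits C x') = D.eqn x' := by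
      rintro _ rfl; exact hu
    exact this _ (hσ.apply_eq x)
  have hfe : (f - e x ^ p) * ((u⁻¹ : C.functionFieldˣ) : C.functionField) ^ p ∈ localRing C x := by
    have hu' : (((u ^ p)⁻¹ : C.functionFieldˣ) : C.functionFieldˣ ⧸ stalkUnits C x) =
        (-(p • D)).eqn x := by
      rw [CartierDivisor.eqn_neg, CartierDivisor.eqn_nsmul, ← hu]; rfl
    have := (CartierDivisor.mem_stalk_iff hu').mp (hlift x)
    rwa [← inv_pow, Units.val_pow_eq_pow_val] at this
  rw [multisection, CartierDivisor.eqn_sub, CartierDivisor.eqn_add, CartierDivisor.eqn_nsmul,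
    CartierDivisor.eqn_nsmul, ← hLH, ← CartierDivisor.eqn_pullback π huπ,
    CartierDivisor.eqn_principalDivisor]
  set u' : P.functionFieldˣ := Units.map (functionFieldMap π).toMonoidHom u with hu'
  have hu'val : (u' : P.functionField) = functionFieldMap π u := rfl
  refine (QuotientGroup.eq_one_iff (τ * (L⁻¹) ^ p / u' ^ p)).mpr ?_
  have hp : p ≠ 0 := (Fact.out : p.Prime).ne_zero
  obtain ⟨a, ha⟩ : functionFieldMap π ((f - e x ^ p) * ((u⁻¹ : C.functionFieldˣ) : C.functionField) ^ p) ∈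
      localRing P (σ x) := functionFieldMap_mem_localRing π (by rwa [hσ.apply_eq])
  -- Here `u L = e_x + y`, so in characteristic `p` one has `τ = f + yᵖ = (f - e_xᵖ) + (u L)ᵖ`.
  -- Division by `(u L)ᵖ` gives `1 + a gᵖ` with `g = L⁻¹` and `a = (f - e_xᵖ) u⁻ᵖ` regular by the
  -- lifting condition.
  have hval : ((τ * (L⁻¹) ^ p / u' ^ p : P.functionFieldˣ) : P.functionField) =
      algebraMap (P.presheaf.stalk (σ x)) P.functionField (1 + a * g ^ p) := by
    have hu0 : functionFieldMap π u ≠ 0 := hu'val ▸ u'.ne_zero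
    have hL0 := L.ne_zero
    have hLy : functionFieldMap π u * L = functionFieldMap π (e x) + y := by
      rw [hL, linearForm, Units.val_inv_eq_inv_val]
      simp only [map_mul, map_inv₀]
      field_simp
    have hτ' : (τ : P.functionField) = functionFieldMap π (f - e x ^ p) +
        (functionFieldMap π u * L) ^ p := by
      rw [hLy, add_pow_char, hτ, map_sub, map_pow]
      ring
    rw [map_add, map_one, map_mul, map_pow, ha, hg, Units.val_div_eq_div_val, Units.val_mul,
      Units.val_pow_eq_pow_val, Units.val_pow_eq_pow_val, hu'val, hτ']
    simp only [map_mul, map_pow, Units.val_inv_eq_inv_val, map_inv₀]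
    generalize functionFieldMap π (f - e x ^ p) = A
    rw [mul_pow, add_mul, mul_assoc, ← mul_pow, mul_inv_cancel₀ hL0, one_pow, mul_one, add_div,
      div_self (pow_ne_zero _ hu0), add_comm, inv_pow _ p, inv_pow _ p]
    ring
  -- The map of stalks is local, so invertibility can be tested after pullback by `σ`, where `g`
  -- becomes `0`.
  have hunit : IsUnit (1 + a * g ^ p) := by
    rw [← isUnit_map_iff (σ.stalkMap x).hom]
    rw [map_add, map_one, map_mul, map_pow]
    change IsUnit (1 + _ * (σ.stalkMap x g) ^ p)
    rw [hg', zero_pow hp, mul_zero, add_zero]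
    exact isUnit_one
  exact ⟨hunit.unit, Units.ext hval.symm⟩

end QuotientSection

/-! ### The ideal of the reduced preimage on an affine open -/

section VanishingIdeal

variable {P X : Scheme.{u}}

/-- The preimage is cut out set-theoretically by the pullback of `t`, and the vanishing ideal of a
zero locus is the radical. -/
lemma reducedPreimage_ideal (ψ : X ⟶ P) [IsAffineHom ψ] (I : P.IdealSheafData) (U : P.affineOpens)
    (t : Γ(P, U)) (ht : I.ideal U = Ideal.span {t}) :
    (reducedPreimage ψ I.support).ideal ⟨ψ ⁻¹ᵁ U, U.2.preimage ψ⟩ =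
      (Ideal.span {ψ.app U t}).radical := by
  have hV : IsAffineOpen (ψ ⁻¹ᵁ (U : P.Opens)) := U.2.preimage ψ
  rw [reducedPreimage, Scheme.IdealSheafData.vanishingIdeal_ideal,
    ← PrimeSpectrum.vanishingIdeal_zeroLocus_eq_radical]
  congr 1
  ext x
  have hxV : hV.fromSpec x ∈ ψ ⁻¹ᵁ (U : P.Opens) := by
    have := Set.mem_range_self (f := hV.fromSpec) x
    rwa [hV.range_fromSpec] at this
  have hb := hV.fromSpec_preimage_basicOpen (ψ.app U t)
  have hb' : hV.fromSpec x ∈ X.basicOpen (ψ.app U t) ↔ ψ.app U t ∉ x.asIdeal := by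
    rw [← PrimeSpectrum.mem_basicOpen, ← hb]
    rfl
  rw [PrimeSpectrum.zeroLocus_span, PrimeSpectrum.mem_zeroLocus, Set.singleton_subset_iff]
  change ψ (hV.fromSpec x) ∈ I.support ↔ _
  rw [Scheme.IdealSheafData.mem_support_iff_of_mem (U := U) hxV, ht, Scheme.zeroLocus_span,
    Scheme.zeroLocus_singleton, SetLike.mem_coe, Set.mem_compl_iff, SetLike.mem_coe,
    ← not_iff_comm.mp hb'.symm, ← Scheme.preimage_basicOpen]
  rfl

end VanishingIdeal

/-! ### Sections of the powers of the ideal on the cyclic cover -/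

section Cover

variable {P X : Scheme.{u}} [IsIntegral P] {ψ : X ⟶ P} {l : ℕ} [NeZero l]
  {M E B : CartierDivisor P} {θ : P.functionFieldˣ}

lemma CyclicCover.mem_range_iff_rootCoord (hX : CyclicCover ψ l M θ) (U : P.Opens) [Nonempty U]
    (a : GenericAlgebra l (θ : P.functionField)) :
    a ∈ (hX.toAlg U).range ↔ ∀ i : Fin l, ∀ w ∈ U, rootCoord i a ∈ ((i : ℕ) • M).stalk w := by
  rw [hX.mem_range_iff]
  constructor
  · rintro ⟨g, hg, rfl⟩ i w hw
    rw [rootCoord_sum]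
    exact hg i w hw
  · exact fun h => ⟨fun i => rootCoord i a, h, (sum_rootCoord a).symm⟩

lemma germToFunctionField_range (U : P.Opens) [Nonempty U] (g : P.functionField) :
    g ∈ (P.germToFunctionField U).hom.range ↔ ∀ w ∈ U, g ∈ localRing P w := by
  constructor
  · rintro ⟨s, rfl⟩ w hw
    exact germToFunctionField_mem_localRing hw s
  · intro h
    obtain ⟨s, hs⟩ := exists_section_of_forall_mem_localRing U g h
    exact ⟨s, hs⟩

lemma forall_mem_stalk_iff_isInFiltration {U : P.Opens} [Nonempty U] {m t : P.functionFieldˣ}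
    (hm : ∀ w ∈ U, (m : P.functionFieldˣ ⧸ stalkUnits P w) = M.eqn w)
    (ht : ∀ w ∈ U, (t : P.functionFieldˣ ⧸ stalkUnits P w) = E.eqn w) (n : ℕ)
    (a : GenericAlgebra l (θ : P.functionField)) :
    (∀ i : Fin l, ∀ w ∈ U,
        rootCoord i a ∈ ((i : ℕ) • M - divExp l n i • E).stalk w) ↔
      IsInFiltration (P.germToFunctionField U).hom.range (m : P.functionField) t n a := by
  refine forall_congr' fun i => ?_
  rw [germToFunctionField_range]
  refine forall₂_congr fun w hw => ?_
  have h : ((m ^ (i : ℕ) / t ^ divExp l n i : P.functionFieldˣ) :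
      P.functionFieldˣ ⧸ stalkUnits P w) = ((i : ℕ) • M - divExp l n i • E).eqn w := by
    rw [CartierDivisor.eqn_sub, CartierDivisor.eqn_nsmul, CartierDivisor.eqn_nsmul, ← hm w hw,
      ← ht w hw]
    rfl
  rw [CartierDivisor.mem_stalk_iff h, Units.val_div_eq_div_val, Units.val_pow_eq_pow_val,
    Units.val_pow_eq_pow_val, mul_div_assoc]

/-- Sections of the `n`-th power of the ideal of the reduced preimage of `V(I)`, where `V(I)` is the
integral effective divisor `E`, over a small affine open. -/
lemma CyclicCover.exists_affineOpens_mem_ideal_iff (hX : CyclicCover ψ l M θ)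
    {I : P.IdealSheafData} (hI : ∀ U, (I.ideal U).IsRadical) (hE : E.IsDivisorOf I)
    (hEeff : E.IsEffective) (hθ : principalDivisor θ = l • M + (E + B))
    (hB : ∀ w ∈ I.support, B.eqn w = 1) (n : ℕ) {w₀ : P} {W : P.Opens} (hw₀ : w₀ ∈ W) :
    ∃ U : P.affineOpens, ∃ _ : Nonempty (U : P.Opens), w₀ ∈ (U : P.Opens) ∧ (U : P.Opens) ≤ W ∧
      ∃ hU : IsAffineOpen (ψ ⁻¹ᵁ (U : P.Opens)), ∀ s : Γ(X, ψ ⁻¹ᵁ (U : P.Opens)),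
        s ∈ (reducedPreimage ψ I.support ^ n).ideal ⟨_, hU⟩ ↔
          ∀ i : Fin l, ∀ w ∈ (U : P.Opens),
            rootCoord i (hX.toAlg U s) ∈ ((i : ℕ) • M - divExp l n i • E).stalk w := by
  have := hX.isAffineHom
  obtain ⟨U₁, hw₁, m, hm⟩ := M.exists_eqn w₀
  obtain ⟨U₂, hw₂, t, ht⟩ := E.exists_eqn w₀
  -- Either `w₀` is off `E` and `t` is a unit nearby, or `w₀` is on `E`, where `B` has equation `1`
  -- and so `θ` equals `mˡ t` up to a unit `ε`.
  have key : ∃ U₃ : P.Opens, w₀ ∈ U₃ ∧ ((∀ w ∈ U₃, (t : P.functionField)⁻¹ ∈ localRing P w) ∨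
      ∃ ε : P.functionFieldˣ, (θ : P.functionField) = m ^ l * (ε * t) ∧
        ∀ w ∈ U₃, (ε : P.functionField) ∈ localRing P w ∧ (ε : P.functionField)⁻¹ ∈ localRing P w) := by
    by_cases hw : w₀ ∈ I.support
    · have h1 : (θ : P.functionFieldˣ ⧸ stalkUnits P w₀) = (m ^ l * t : P.functionFieldˣ) := by
        have h0 := congrArg (fun Δ => Δ.eqn w₀) hθ
        simp only [CartierDivisor.eqn_add, CartierDivisor.eqn_nsmul, hB w₀ hw, ← hm w₀ hw₁,
          ← ht w₀ hw₂] at h0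
        exact h0.trans (congrArg ((m : P.functionFieldˣ ⧸ stalkUnits P w₀) ^ l * ·)
          (mul_one (t : P.functionFieldˣ ⧸ stalkUnits P w₀)))
      have h2 := mk_eq_mk_iff.mp h1
      obtain ⟨V₁, hV₁, hV₁'⟩ := eventually_mem_localRing h2.1
      obtain ⟨V₂, hV₂, hV₂'⟩ := eventually_mem_localRing h2.2
      refine ⟨V₁ ⊓ V₂, ⟨hV₁, hV₂⟩, Or.inr ⟨θ / (m ^ l * t), ?_, fun w hw => ⟨?_, ?_⟩⟩⟩
      · rw [Units.val_div_eq_div_val, Units.val_mul, Units.val_pow_eq_pow_val, mul_left_comm,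
          div_mul_cancel₀]
        exact (m ^ l * t : P.functionFieldˣ).ne_zero
      · rw [Units.val_div_eq_div_val]
        exact hV₂' w hw.2
      · rw [Units.val_div_eq_div_val, inv_div]
        exact hV₁' w hw.1
    · obtain ⟨V, hV, -⟩ := exists_affineOpens_le (Opens.mem_top w₀)
      have : Nonempty (V : P.Opens) := ⟨⟨w₀, hV⟩⟩
      rw [Scheme.IdealSheafData.mem_support_iff_of_mem hV, Scheme.mem_zeroLocus_iff] at hw
      push Not at hw
      obtain ⟨s, hs, hsw⟩ := hw
      have ht' : ((t⁻¹ : P.functionFieldˣ) : P.functionFieldˣ ⧸ stalkUnits P w₀) = (-E).eqn w₀ := by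
        rw [CartierDivisor.eqn_neg, ← ht w₀ hw₂]; rfl
      -- Off the support some `s ∈ I` is a unit at `w₀`; since `s / t` is regular, so is `t⁻¹`.
      have h1 := (CartierDivisor.mem_stalk_iff ht').mp ((hE V s).mp hs w₀ hV)
      rw [Scheme.mem_basicOpen _ _ _ hV] at hsw
      obtain ⟨b, hb⟩ := hsw.exists_left_inv
      have h2 : (t : P.functionField)⁻¹ ∈ localRing P w₀ := by
        have h3 := mul_mem (show _ ∈ localRing P w₀ from ⟨b, rfl⟩) h1
        rwa [← mul_assoc, ← Scheme.algebraMap_germ_eq_germToFunctionField P hV, ← map_mul, hb,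
          map_one, one_mul, Units.val_inv_eq_inv_val] at h3
      obtain ⟨V₁, hV₁, hV₁'⟩ := eventually_mem_localRing h2
      exact ⟨V₁, hV₁, Or.inl hV₁'⟩
  obtain ⟨U₃, hw₃, hU₃⟩ := key
  obtain ⟨U, hwU, hle⟩ := exists_affineOpens_le (U := W ⊓ (U₁ ⊓ (U₂ ⊓ U₃))) ⟨hw₀, hw₁, hw₂, hw₃⟩
  have hne : Nonempty (U : P.Opens) := ⟨⟨w₀, hwU⟩⟩
  refine ⟨U, hne, hwU, fun w hw => (hle hw).1, U.2.preimage ψ, fun s => ?_⟩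
  replace hm : ∀ w ∈ (U : P.Opens), _ := fun w hw => hm w (hle hw).2.1
  replace ht : ∀ w ∈ (U : P.Opens), _ := fun w hw => ht w (hle hw).2.2.1
  have htR : (t : P.functionField) ∈ (P.germToFunctionField U).hom.range := by
    rw [germToFunctionField_range]
    intro w hw
    have := (CartierDivisor.mem_stalk_iff (ht w hw)).mp (hEeff w)
    rwa [one_mul] at this
  have hIdeal (s : Γ(P, U)) : s ∈ I.ideal U ↔
      P.germToFunctionField U s / t ∈ (P.germToFunctionField U).hom.range := by
    rw [hE U, germToFunctionField_range]
    refine forall₂_congr fun w hw => ?_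
    have ht' : ((t⁻¹ : P.functionFieldˣ) : P.functionFieldˣ ⧸ stalkUnits P w) = (-E).eqn w := by
      rw [CartierDivisor.eqn_neg, ← ht w hw]; rfl
    rw [CartierDivisor.mem_stalk_iff ht', Units.val_inv_eq_inv_val, div_eq_mul_inv]
  obtain ⟨t', ht'⟩ := htR
  change P.germToFunctionField U t' = _ at ht'
  have hspan : I.ideal U = Ideal.span {t'} := by
    ext s
    rw [hIdeal, Ideal.mem_span_singleton]
    constructor
    · rintro ⟨r, hr⟩
      refine ⟨r, P.germToFunctionField_injective U ?_⟩
      change P.germToFunctionField U r = _ at hr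
      rw [map_mul, ht', hr, mul_div_cancel₀ _ t.ne_zero]
    · rintro ⟨r, rfl⟩
      refine ⟨r, ?_⟩
      rw [map_mul, ht', mul_div_cancel_left₀ _ t.ne_zero]
  rw [forall_mem_stalk_iff_isInFiltration hm ht, Scheme.IdealSheafData.ideal_pow, Pi.pow_apply,
    reducedPreimage_ideal ψ I U t' hspan]
  have hrange (a : GenericAlgebra l (θ : P.functionField)) : a ∈ (hX.toAlg U).range ↔
      IsInFiltration (P.germToFunctionField U).hom.range (m : P.functionField) t 0 a := by
    rw [hX.mem_range_iff_rootCoord, ← forall_mem_stalk_iff_isInFiltration hm ht]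
    refine forall_congr' fun i => ?_
    rw [divExp_zero i.2, zero_smul, sub_zero]
  rcases hU₃ with htinv | ⟨ε, hε, hεU⟩
  · have htu : (t : P.functionField)⁻¹ ∈ (P.germToFunctionField U).hom.range := by
      rw [germToFunctionField_range]
      exact fun w hw => htinv w (hle hw).2.2.2
    obtain ⟨v, hv⟩ := htu
    change P.germToFunctionField U v = _ at hv
    have hunit : IsUnit t' := by
      refine IsUnit.of_mul_eq_one v (P.germToFunctionField_injective U ?_)
      rw [map_mul, ht', hv, map_one, mul_inv_cancel₀ t.ne_zero]
    -- Where `t` is a unit, the ideal is everything and division by powers of `t` imposes no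
    -- condition.
    have htop : (Ideal.span {ψ.app U t'}).radical = ⊤ := by
      rw [Ideal.radical_eq_top, Ideal.span_singleton_eq_top]
      exact hunit.map (ψ.app U).hom
    rw [htop, Ideal.top_pow]
    refine ⟨fun _ i => ?_, fun _ => Submodule.mem_top⟩
    have h0 := (hrange _).mp ⟨s, rfl⟩ i
    rw [divExp_zero i.2, pow_zero, div_one] at h0
    rw [div_eq_mul_inv, ← inv_pow]
    have hvR : (t : P.functionField)⁻¹ ∈ (P.germToFunctionField U).hom.range := ⟨v, hv⟩
    exact mul_mem h0 (pow_mem hvR _)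
  · refine mem_pow_radical_iff (hX.toAlg U) (hX.injective U) hrange m.ne_zero ⟨t', ht'⟩ t.ne_zero
      ((germToFunctionField_range _ _).mpr fun w hw => (hεU w (hle hw).2.2.2).1)
      ((germToFunctionField_range _ _).mpr fun w hw => (hεU w (hle hw).2.2.2).2) ε.ne_zero hε
      ?_ ?_ n s
    · rintro _ ⟨r, rfl⟩ N hN
      have h1 : r ^ N ∈ I.ideal U := by
        rw [hIdeal, map_pow]
        exact hN
      exact (hIdeal r).mp (hI U (Ideal.mem_radical_iff.mpr ⟨N, h1⟩))
    · rw [hX.map_app, ht']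

/-- Global description of the sections of the `n`-th power of the ideal of the reduced preimage. -/
lemma CyclicCover.app_subschemeι_eq_zero_iff (hX : CyclicCover ψ l M θ)
    {I : P.IdealSheafData} (hI : ∀ U, (I.ideal U).IsRadical) (hE : E.IsDivisorOf I)
    (hEeff : E.IsEffective) (hθ : principalDivisor θ = l • M + (E + B))
    (hB : ∀ w ∈ I.support, B.eqn w = 1) (n : ℕ) (W : P.Opens) [Nonempty W] (s : Γ(X, ψ ⁻¹ᵁ W)) :
    (reducedPreimage ψ I.support ^ n).subschemeι.app (ψ ⁻¹ᵁ W) s = 0 ↔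
      ∀ i : Fin l, ∀ w ∈ W,
        rootCoord i (hX.toAlg W s) ∈ ((i : ℕ) • M - divExp l n i • E).stalk w := by
  set J := reducedPreimage ψ I.support ^ n with hJ
  have hloc (U : P.affineOpens) (hUW : (U : P.Opens) ≤ W) (hU : IsAffineOpen (ψ ⁻¹ᵁ (U : P.Opens))) :
      X.presheaf.map (homOfLE (ψ.preimage_mono hUW)).op s ∈ J.ideal ⟨_, hU⟩ ↔
        J.subscheme.presheaf.map (homOfLE (J.subschemeι.preimage_mono (ψ.preimage_mono hUW))).op
          (J.subschemeι.app (ψ ⁻¹ᵁ W) s) = 0 := by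
    rw [← J.ker_subschemeι_app, RingHom.mem_ker]
    refine Eq.congr ?_ rfl
    exact congrArg (fun φ => φ.hom s) (J.subschemeι.naturality (homOfLE (ψ.preimage_mono hUW)).op)
  constructor
  · intro h i w hw
    obtain ⟨U, _, hwU, hUW, hU, key⟩ :=
      hX.exists_affineOpens_mem_ideal_iff hI hE hEeff hθ hB n hw
    rw [← hX.map_res hUW]
    refine (key _).mp ((hloc U hUW hU).mpr ?_) i w hwU
    rw [h, map_zero]
  · intro h
    refine TopCat.Presheaf.section_ext J.subscheme.sheaf _ _ _ fun x hx => ?_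
    obtain ⟨U, _, hwU, hUW, hU, key⟩ :=
      hX.exists_affineOpens_mem_ideal_iff hI hE hEeff hθ hB n (w₀ := ψ (J.subschemeι x)) hx
    have h1 := (hloc U hUW hU).mp ((key _).mpr fun i w hw => by
      rw [hX.map_res hUW]
      exact h i w (hUW hw))
    have hx' : x ∈ J.subschemeι ⁻¹ᵁ ψ ⁻¹ᵁ (U : P.Opens) := hwU
    have h2 := J.subscheme.presheaf.germ_res_apply
      (homOfLE (J.subschemeι.preimage_mono (ψ.preimage_mono hUW))) x hx'
      (J.subschemeι.app (ψ ⁻¹ᵁ W) s)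
    rw [h1, map_zero] at h2
    exact h2.symm.trans (map_zero _).symm

end Cover

/-! ### Morphisms of sheaves of modules and the pushforward of an ideal sheaf -/

section ModulesHom

variable {X : Scheme.{u}}

/-- A morphism of `𝒪_X`-modules from compatible linear maps on sections. -/
def modulesHomMk {M N : X.Modules} (φ : ∀ U : X.Opens, Γ(M, U) →+ Γ(N, U))
    (hmap : ∀ {U V : X.Opens} (h : V ≤ U) (s : Γ(M, U)),
      φ V (M.presheaf.map (homOfLE h).op s) = N.presheaf.map (homOfLE h).op (φ U s))
    (hsmul : ∀ (U : X.Opens) (r : Γ(X, U)) (s : Γ(M, U)), φ U (r • s) = r • φ U s) : M ⟶ N :=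
  ⟨PresheafOfModules.homMk (M₁ := M.val) (M₂ := N.val)
    { app := fun U => AddCommGrpCat.ofHom (φ U.unop)
      naturality := fun U V f => by
        ext s
        exact hmap f.unop.le s }
    (fun U r s => hsmul U.unop r s)⟩

/-- Evaluation of a morphism of modules at a section, as a function of the morphism. -/
def modulesHomEval {M N : X.Modules} (U : X.Opens) (s : Γ(M, U)) : (M ⟶ N) →+ Γ(N, U) where
  toFun φ := φ.app U s
  map_zero' := rfl
  map_add' _ _ := rfl

lemma modulesHom_ext {M N : X.Modules} {φ φ' : M ⟶ N}
    (h : ∀ (U : X.Opens) (s : Γ(M, U)), φ.app U s = φ'.app U s) : φ = φ' := by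
  refine Scheme.Modules.hom_ext _ _ fun U => ?_
  ext s
  exact h U s

/-- The structure sheaf as a module over itself. -/
abbrev structureModule (X : Scheme.{u}) : X.Modules := SheafOfModules.unit X.ringCatSheaf

/-- The map `𝒪_X → i_* 𝒪_{V(J)}`. -/
abbrev toSubscheme (J : X.IdealSheafData) : structureModule X ⟶
    (Scheme.Modules.pushforward J.subschemeι).obj (structureModule J.subscheme) :=
  SheafOfModules.unitToPushforwardObjUnit J.subschemeι.toRingCatSheafHom

variable {P : Scheme.{u}} (ψ : X ⟶ P) (J : X.IdealSheafData)

/-- The inclusion `J → 𝒪_X`. -/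
def idealSheafι : idealSheaf J ⟶ structureModule X :=
  kernel.ι (toSubscheme J)

lemma idealSheafι_comp : idealSheafι J ≫ toSubscheme J = 0 :=
  kernel.condition (toSubscheme J)

instance : Mono (idealSheafι J) :=
  inferInstanceAs (Mono (kernel.ι (toSubscheme J)))

/-- The inclusion `ψ_* J → ψ_* 𝒪_X`. -/
def pushforwardIdealι : (Scheme.Modules.pushforward ψ).obj (idealSheaf J) ⟶
    (Scheme.Modules.pushforward ψ).obj (structureModule X) :=
  (Scheme.Modules.pushforward ψ).map (idealSheafι J)

lemma pushforwardIdealι_comp :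
    pushforwardIdealι ψ J ≫ (Scheme.Modules.pushforward ψ).map (toSubscheme J) = 0 := by
  rw [pushforwardIdealι, ← Functor.map_comp, idealSheafι_comp, Functor.map_zero]

instance : Mono (pushforwardIdealι ψ J) :=
  inferInstanceAs (Mono ((Scheme.Modules.pushforward ψ).map (idealSheafι J)))

lemma app_pushforwardIdealι (U : P.Opens)
    (s : Γ((Scheme.Modules.pushforward ψ).obj (idealSheaf J), U)) :
    J.subschemeι.app (ψ ⁻¹ᵁ U) ((pushforwardIdealι ψ J).app U s) = 0 :=
  congrArg (fun φ => φ.app U s) (pushforwardIdealι_comp ψ J)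

/-- Pushforward preserves kernels, so `ψ_* J` is the kernel of `ψ_* 𝒪_X → ψ_* i_* 𝒪_{V(J)}`, and
vanishing can be checked on sections. -/
lemma exists_lift_pushforwardIdeal {M : P.Modules}
    (φ : M ⟶ (Scheme.Modules.pushforward ψ).obj (structureModule X))
    (h : ∀ (U : P.Opens) (s : Γ(M, U)), J.subschemeι.app (ψ ⁻¹ᵁ U) (φ.app U s) = 0) :
    ∃ φ' : M ⟶ (Scheme.Modules.pushforward ψ).obj (idealSheaf J),
      φ' ≫ pushforwardIdealι ψ J = φ := by
  have hφ : φ ≫ (Scheme.Modules.pushforward ψ).map (toSubscheme J) = 0 :=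
    modulesHom_ext fun U s => h U s
  obtain ⟨g, hg⟩ := KernelFork.IsLimit.lift' (isLimitOfHasKernelOfPreservesLimit
    (Scheme.Modules.pushforward ψ) (toSubscheme J)) φ hφ
  exact ⟨g, hg⟩

end ModulesHom

/-! ### Recognizing a direct sum from inclusions and projections -/

section Biproduct

variable {𝒞 : Type*} [Category 𝒞] [Preadditive 𝒞] [HasFiniteBiproducts 𝒞]
  [HasBinaryBiproducts 𝒞]

lemma nonempty_iso_biprod_biproduct {K : 𝒞} {r s : ℕ} {F : Fin r → 𝒞} {G : Fin s → 𝒞}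
    (a : ∀ i, F i ⟶ K) (a' : ∀ i, G i ⟶ K) (b : ∀ i, K ⟶ F i) (b' : ∀ i, K ⟶ G i)
    (hab : ∀ i, a i ≫ b i = 𝟙 _) (hab' : ∀ i, a' i ≫ b' i = 𝟙 _)
    (hne : ∀ i j, i ≠ j → a i ≫ b j = 0) (hne' : ∀ i j, i ≠ j → a' i ≫ b' j = 0)
    (h₁ : ∀ i j, a i ≫ b' j = 0) (h₂ : ∀ i j, a' i ≫ b j = 0)
    (hsum : ∑ i, b i ≫ a i + ∑ i, b' i ≫ a' i = 𝟙 K) : Nonempty (K ≅ (⨁ F) ⊞ (⨁ G)) := by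
  refine ⟨⟨biprod.lift (biproduct.lift b) (biproduct.lift b'),
    biprod.desc (biproduct.desc a) (biproduct.desc a'), ?_, ?_⟩⟩
  · rw [biprod.lift_desc, biproduct.lift_desc, biproduct.lift_desc, hsum]
  · ext i j
    · simp only [Category.assoc, biprod.inl_desc_assoc, biproduct.ι_desc_assoc, biprod.lift_fst,
        biproduct.lift_π, Category.comp_id, biprod.inl_fst_assoc]
      rcases eq_or_ne i j with rfl | h
      · rw [hab, biproduct.ι_π_self]
      · rw [hne i j h, biproduct.ι_π_ne _ h]
    · simp [h₁]
    · simp [h₂]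
    · simp only [Category.assoc, biprod.inr_desc_assoc, biproduct.ι_desc_assoc, biprod.lift_snd,
        biproduct.lift_π, Category.comp_id, biprod.inr_snd_assoc]
      rcases eq_or_ne i j with rfl | h
      · rw [hab', biproduct.ι_π_self]
      · rw [hne' i j h, biproduct.ι_π_ne _ h]

end Biproduct

/-! ### The decomposition of `ψ_* J` into line bundles -/

section Decomposition

variable {P X : Scheme.{u}} [IsIntegral P] {ψ : X ⟶ P} {l : ℕ} [NeZero l]
  {M E B : CartierDivisor P} {θ : P.functionFieldˣ}

omit [NeZero l] in
-- `toAlg` is available only over nonempty opens; over the empty one any two sections agree, as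
-- there are no germs to compare.
lemma CyclicCover.section_ext (hX : CyclicCover ψ l M θ) {U : P.Opens} {s t : Γ(X, ψ ⁻¹ᵁ U)}
    (h : ∀ _ : Nonempty U, hX.toAlg U s = hX.toAlg U t) : s = t := by
  by_cases hU : Nonempty U
  · exact hX.injective U (h hU)
  · refine TopCat.Presheaf.section_ext X.sheaf _ _ _ fun x hx => ?_
    exact absurd ⟨⟨ψ x, hx⟩⟩ hU

lemma CyclicCover.exists_monomial (hX : CyclicCover ψ l M θ) (i : Fin l) (Δ : CartierDivisor P)
    (hΔ : ∀ w, (Δ.stalk w : Set P.functionField) ⊆ ((i : ℕ) • M).stalk w) (U : P.Opens)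
    (s : Δ.sections U) :
    ∃ t : Γ(X, ψ ⁻¹ᵁ U), ∀ (_ : Nonempty U) (x : U),
      hX.toAlg U t = AdjoinRoot.of _ (s.1 x) * AdjoinRoot.root _ ^ (i : ℕ) := by
  by_cases hU : Nonempty U
  · let x₀ : U := Classical.arbitrary U
    obtain ⟨t, ht⟩ : AdjoinRoot.of _ (s.1 x₀) * AdjoinRoot.root _ ^ (i : ℕ) ∈
        (hX.toAlg U).range := by
      rw [hX.mem_range_iff_rootCoord]
      intro j w hw
      rw [rootCoord_of_mul, rootCoord_root_pow]
      split_ifs with hij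
      · rw [mul_one, ← hij, s.2.1 x₀ ⟨w, hw⟩]
        exact hΔ w (s.2.2 ⟨w, hw⟩)
      · rw [mul_zero]
        exact zero_mem _
    exact ⟨t, fun _ x => by rw [ht, s.2.1 x x₀]⟩
  · exact ⟨0, fun h => absurd h hU⟩

/-- The map `𝒪_P(Δ) → ψ_* 𝒪_X`, `g ↦ g Tⁱ`, for a divisor `Δ ≤ i M`. -/
def CyclicCover.monomialHom (hX : CyclicCover ψ l M θ) (i : Fin l) (Δ : CartierDivisor P)
    (hΔ : ∀ w, (Δ.stalk w : Set P.functionField) ⊆ ((i : ℕ) • M).stalk w) :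
    Δ.lineBundle ⟶ (Scheme.Modules.pushforward ψ).obj (structureModule X) :=
  modulesHomMk
    (fun U => AddMonoidHom.mk' (fun s : Δ.sections U => (hX.exists_monomial i Δ hΔ U s).choose)
      -- The chosen sections are determined by their images under `toAlg`, so additivity, and below
      -- compatibility with restriction and scalars, can be checked there.
      (fun s t => hX.section_ext fun hU => by
        let x : U := Classical.arbitrary U
        refine Eq.trans ?_ (map_add (hX.toAlg U) _ _).symm
        rw [(hX.exists_monomial i Δ hΔ U s).choose_spec hU x,
          (hX.exists_monomial i Δ hΔ U t).choose_spec hU x,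
          (hX.exists_monomial i Δ hΔ U (s + t)).choose_spec hU x, ← add_mul, ← map_add]
        rfl))
    (fun {U V} h s => hX.section_ext fun hV => by
      have hU : Nonempty U := hV.map fun x => ⟨x.1, h x.2⟩
      let x : V := Classical.arbitrary V
      refine Eq.trans ?_ (hX.map_res h _).symm
      exact ((hX.exists_monomial i Δ hΔ V (Δ.res h s)).choose_spec hV x).trans
        ((hX.exists_monomial i Δ hΔ U s).choose_spec hU ⟨x.1, h x.2⟩).symm)
    (fun U r s => hX.section_ext fun hU => by
      let x : U := Classical.arbitrary U
      refine ((hX.exists_monomial i Δ hΔ U (r • (show Δ.sections U from s))).choose_spec hU x).trans ?_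
      refine Eq.trans ?_ (map_mul (hX.toAlg U) (ψ.app U r) _).symm
      have h1 : ((r • (show Δ.sections U from s) : Δ.sections U) : Values P U) x =
          P.germToFunctionField U r * (show Δ.sections U from s).1 x := by
        refine (smul_values U r _ x).trans ?_
        rw [sectionValues_apply, Scheme.algebraMap_germ_eq_germToFunctionField]
      rw [h1, map_mul, mul_assoc, hX.map_app]
      exact congrArg _ ((hX.exists_monomial i Δ hΔ U s).choose_spec hU x).symm)

lemma CyclicCover.toAlg_monomialHom (hX : CyclicCover ψ l M θ) (i : Fin l) (Δ : CartierDivisor P)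
    (hΔ : ∀ w, (Δ.stalk w : Set P.functionField) ⊆ ((i : ℕ) • M).stalk w) (U : P.Opens)
    [hU : Nonempty U] (s : Δ.sections U) (x : U) :
    hX.toAlg U ((hX.monomialHom i Δ hΔ).app U s) =
      AdjoinRoot.of _ (s.1 x) * AdjoinRoot.root _ ^ (i : ℕ) :=
  (hX.exists_monomial i Δ hΔ U s).choose_spec hU x

/-- The section of `𝒪_P(Δ)` given by the coefficient of `Tⁱ`. -/
def CyclicCover.coeffSection (hX : CyclicCover ψ l M θ) (i : Fin l) (Δ : CartierDivisor P)
    (U : P.Opens) (s : Γ(X, ψ ⁻¹ᵁ U)) (hs : ∀ _ : Nonempty U, ∀ w ∈ U,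
      rootCoord i (hX.toAlg U s) ∈ Δ.stalk w) : Δ.sections U :=
  ⟨fun x => have : Nonempty U := ⟨x⟩; rootCoord i (hX.toAlg U s), fun _ _ => rfl,
    fun x => hs ⟨x⟩ x.1 x.2⟩

/-- The map `ψ_* J → 𝒪_P(Δ)` taking the coefficient of `Tⁱ`. -/
def CyclicCover.coeffHom (hX : CyclicCover ψ l M θ) (J : X.IdealSheafData) (i : Fin l)
    (Δ : CartierDivisor P) (hJ : ∀ (U : P.Opens) [Nonempty U] (s : Γ(X, ψ ⁻¹ᵁ U)),
      J.subschemeι.app (ψ ⁻¹ᵁ U) s = 0 → ∀ w ∈ U, rootCoord i (hX.toAlg U s) ∈ Δ.stalk w) :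
    (Scheme.Modules.pushforward ψ).obj (idealSheaf J) ⟶ Δ.lineBundle :=
  modulesHomMk
    (fun U => AddMonoidHom.mk' (fun s => (hX.coeffSection i Δ U ((pushforwardIdealι ψ J).app U s)
        fun _ => hJ U _ (app_pushforwardIdealι ψ J U s) : Δ.sections U))
      (fun s t => Subtype.ext (funext fun x => by
        have : Nonempty U := ⟨x⟩
        change rootCoord i (hX.toAlg U ((pushforwardIdealι ψ J).app U (s + t))) =
          rootCoord i (hX.toAlg U ((pushforwardIdealι ψ J).app U s)) +
          rootCoord i (hX.toAlg U ((pushforwardIdealι ψ J).app U t))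
        rw [map_add, ← map_add (rootCoord i)]
        exact congrArg _ (map_add (hX.toAlg U) _ _))))
    (fun {U V} h s => Subtype.ext (funext fun x => by
      have : Nonempty V := ⟨x⟩
      have : Nonempty U := ⟨⟨x.1, h x.2⟩⟩
      have h1 : (pushforwardIdealι ψ J).app V
          (((Scheme.Modules.pushforward ψ).obj (idealSheaf J)).presheaf.map (homOfLE h).op s) =
          ((Scheme.Modules.pushforward ψ).obj (structureModule X)).presheaf.map (homOfLE h).op
            ((pushforwardIdealι ψ J).app U s) :=
        congrArg (fun φ => φ.hom s) ((pushforwardIdealι ψ J).mapPresheaf.naturality (homOfLE h).op)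
      change rootCoord i (hX.toAlg V ((pushforwardIdealι ψ J).app V
          (((Scheme.Modules.pushforward ψ).obj (idealSheaf J)).presheaf.map (homOfLE h).op s))) =
        rootCoord i (hX.toAlg U ((pushforwardIdealι ψ J).app U s))
      rw [h1]
      exact congrArg _ (hX.map_res h _)))
    (fun U r s => Subtype.ext (funext fun x => by
      have : Nonempty U := ⟨x⟩
      change rootCoord i (hX.toAlg U ((pushforwardIdealι ψ J).app U (r • s))) =
        sectionValues U r x * rootCoord i (hX.toAlg U ((pushforwardIdealι ψ J).app U s))
      rw [Scheme.Modules.Hom.app_smul, sectionValues_apply,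
        Scheme.algebraMap_germ_eq_germToFunctionField, ← rootCoord_of_mul, ← hX.map_app]
      exact congrArg _ (map_mul (hX.toAlg U) _ _)))

lemma CyclicCover.coeffHom_apply (hX : CyclicCover ψ l M θ) (J : X.IdealSheafData) (i : Fin l)
    (Δ : CartierDivisor P) (hJ) (U : P.Opens) [Nonempty U]
    (s : Γ((Scheme.Modules.pushforward ψ).obj (idealSheaf J), U)) (x : U) :
    (show Δ.sections U from (hX.coeffHom J i Δ hJ).app U s).1 x =
      rootCoord i (hX.toAlg U ((pushforwardIdealι ψ J).app U s)) := rfl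

end Decomposition

section Decomposition

variable {P X : Scheme.{u}} [IsIntegral P] {ψ : X ⟶ P} {l : ℕ} [NeZero l]
  {M E : CartierDivisor P} {θ : P.functionFieldˣ}

lemma CartierDivisor.stalk_sub_nsmul_subset (hE : E.IsEffective) (Δ : CartierDivisor P) (c : ℕ)
    (w : P) : ((Δ - c • E).stalk w : Set P.functionField) ⊆ Δ.stalk w := by
  intro g hg
  obtain ⟨U, hU, u, hu⟩ := Δ.exists_eqn w
  obtain ⟨V, hV, t, ht⟩ := E.exists_eqn w
  have heqn : ((u / t ^ c : P.functionFieldˣ) : P.functionFieldˣ ⧸ stalkUnits P w) =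
      (Δ - c • E).eqn w := by
    rw [eqn_sub, eqn_nsmul, ← hu w hU, ← ht w hV]; rfl
  have h1 := (mem_stalk_iff heqn).mp hg
  have h2 := (mem_stalk_iff (ht w hV)).mp (hE w)
  rw [one_mul] at h2
  have h3 := mul_mem h1 (pow_mem h2 c)
  refine (mem_stalk_iff (hu w hU)).mpr ?_
  rwa [Units.val_div_eq_div_val, Units.val_pow_eq_pow_val, mul_assoc, div_mul_cancel₀] at h3
  exact pow_ne_zero _ t.ne_zero

lemma sum_rootCoord_split {K : Type*} [Field K] {θ : K} {r : ℕ} (hr : r < l)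
    (a : AdjoinRoot (Polynomial.X ^ l - Polynomial.C θ : Polynomial K)) :
    ∑ i : Fin r, AdjoinRoot.of _ (rootCoord (⟨i, i.2.trans hr⟩ : Fin l) a) *
        AdjoinRoot.root _ ^ (i : ℕ) +
      ∑ i : Fin (l - r), AdjoinRoot.of _ (rootCoord (⟨r + i, by omega⟩ : Fin l) a) *
        AdjoinRoot.root _ ^ (r + (i : ℕ)) = a := by
  -- Extending the summands by zero to all of `ℕ` turns the splitting at `r` into one of sums over
  -- ranges.
  let F : ℕ → AdjoinRoot (Polynomial.X ^ l - Polynomial.C θ : Polynomial K) := fun n =>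
    if h : n < l then AdjoinRoot.of _ (rootCoord (⟨n, h⟩ : Fin l) a) * AdjoinRoot.root _ ^ n else 0
  have h1 : ∀ i : Fin r, AdjoinRoot.of _ (rootCoord (⟨i, i.2.trans hr⟩ : Fin l) a) *
      AdjoinRoot.root _ ^ (i : ℕ) = F i := fun i => by
    simp only [F, dif_pos (show (i : ℕ) < l from i.2.trans hr)]
  have h2 : ∀ i : Fin (l - r), AdjoinRoot.of _ (rootCoord (⟨r + i, by omega⟩ : Fin l) a) *
      AdjoinRoot.root _ ^ (r + (i : ℕ)) = F (r + i) := fun i => by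
    simp only [F, dif_pos (show r + (i : ℕ) < l by omega)]
  have h3 : ∀ i : Fin l, AdjoinRoot.of _ (rootCoord i a) * AdjoinRoot.root _ ^ (i : ℕ) = F i :=
    fun i => by simp only [F, dif_pos i.2]
  conv_rhs => rw [← sum_rootCoord a]
  simp only [h1, h2, h3]
  rw [Fin.sum_univ_eq_sum_range, Fin.sum_univ_eq_sum_range (fun i => F (r + i)),
    Fin.sum_univ_eq_sum_range, ← Finset.sum_range_add]
  congr 2
  omega

lemma CyclicCover.monomialHom_coeffHom_same (hX : CyclicCover ψ l M θ) (J : X.IdealSheafData)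
    (i : Fin l) (Δ : CartierDivisor P) (hΔ) (hJ)
    {a : Δ.lineBundle ⟶ (Scheme.Modules.pushforward ψ).obj (idealSheaf J)}
    (ha : a ≫ pushforwardIdealι ψ J = hX.monomialHom i Δ hΔ) :
    a ≫ hX.coeffHom J i Δ hJ = 𝟙 _ := by
  refine modulesHom_ext fun U s => Subtype.ext (funext fun x => ?_)
  have : Nonempty U := ⟨x⟩
  have h1 := hX.coeffHom_apply J i Δ hJ U (a.app U s) x
  have h2 : (pushforwardIdealι ψ J).app U (a.app U s) = (hX.monomialHom i Δ hΔ).app U s :=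
    congrArg (fun φ => φ.app U s) ha
  refine h1.trans ?_
  rw [h2, hX.toAlg_monomialHom i Δ hΔ U s x, rootCoord_of_mul, rootCoord_root_pow, if_pos rfl,
    mul_one]
  rfl

lemma CyclicCover.monomialHom_coeffHom_ne (hX : CyclicCover ψ l M θ) (J : X.IdealSheafData)
    {i j : Fin l} (hij : i ≠ j) (Δ Δ' : CartierDivisor P) (hΔ) (hJ)
    {a : Δ.lineBundle ⟶ (Scheme.Modules.pushforward ψ).obj (idealSheaf J)}
    (ha : a ≫ pushforwardIdealι ψ J = hX.monomialHom i Δ hΔ) :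
    a ≫ hX.coeffHom J j Δ' hJ = 0 := by
  refine modulesHom_ext fun U s => Subtype.ext (funext fun x => ?_)
  have : Nonempty U := ⟨x⟩
  have h1 := hX.coeffHom_apply J j Δ' hJ U (a.app U s) x
  have h2 : (pushforwardIdealι ψ J).app U (a.app U s) = (hX.monomialHom i Δ hΔ).app U s :=
    congrArg (fun φ => φ.app U s) ha
  refine h1.trans ?_
  rw [h2, hX.toAlg_monomialHom i Δ hΔ U s x, rootCoord_of_mul, rootCoord_root_pow, if_neg hij,
    mul_zero]
  rfl

lemma CyclicCover.toAlg_coeffHom_comp_monomialHom (hX : CyclicCover ψ l M θ) (J : X.IdealSheafData)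
    (i : Fin l) (Δ : CartierDivisor P) (hΔ) (hJ) (U : P.Opens) [Nonempty U]
    (s : Γ((Scheme.Modules.pushforward ψ).obj (idealSheaf J), U)) :
    hX.toAlg U ((hX.coeffHom J i Δ hJ ≫ hX.monomialHom i Δ hΔ).app U s) =
      AdjoinRoot.of _ (rootCoord i (hX.toAlg U ((pushforwardIdealι ψ J).app U s))) *
        AdjoinRoot.root _ ^ (i : ℕ) :=
  hX.toAlg_monomialHom i Δ hΔ U ((hX.coeffHom J i Δ hJ).app U s) (Classical.arbitrary U)

/-- If the sections of the ideal sheaf `J` of the cyclic cover are characterized by the order of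
vanishing of their coefficients along `E`, then `ψ_* J` is a direct sum of line bundles. -/
lemma CyclicCover.nonempty_pushforward_iso (hX : CyclicCover ψ l M θ) (J : X.IdealSheafData)
    (hE : E.IsEffective) {n q r : ℕ} (hn : n = q * l + r) (hr : r < l)
    (hJ : ∀ (U : P.Opens) [Nonempty U] (s : Γ(X, ψ ⁻¹ᵁ U)),
      J.subschemeι.app (ψ ⁻¹ᵁ U) s = 0 ↔ ∀ i : Fin l, ∀ w ∈ U,
        rootCoord i (hX.toAlg U s) ∈ ((i : ℕ) • M - divExp l n i • E).stalk w) :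
    Nonempty ((Scheme.Modules.pushforward ψ).obj (idealSheaf J) ≅
      (⨁ fun i : Fin r => ((i : ℕ) • M - (q + 1) • E).lineBundle) ⊞
        (⨁ fun i : Fin (l - r) => ((r + (i : ℕ)) • M - q • E).lineBundle)) := by
  have hexp₁ (i : ℕ) (hi : i < r) : divExp l n i = q + 1 := divExp_of_lt hn hi hr
  have hexp₂ (i : ℕ) (hi : r ≤ i) (hil : i < l) : divExp l n i = q := divExp_of_ge hn hi hil
  -- Keeping `Δ` variable, with an equation, lets the line bundles retain the exponents `q + 1` and
  -- `q` without transport along equalities of divisors.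
  have hmono (i : Fin l) (Δ : CartierDivisor P) (h : Δ = (i : ℕ) • M - divExp l n i • E) :
      ∀ w, (Δ.stalk w : Set P.functionField) ⊆ ((i : ℕ) • M).stalk w := by
    rw [h]
    exact CartierDivisor.stalk_sub_nsmul_subset hE _ _
  have hcoeff (i : Fin l) (Δ : CartierDivisor P) (h : Δ = (i : ℕ) • M - divExp l n i • E)
      (U : P.Opens) [Nonempty U] (s : Γ(X, ψ ⁻¹ᵁ U)) (hs : J.subschemeι.app (ψ ⁻¹ᵁ U) s = 0) :
      ∀ w ∈ U, rootCoord i (hX.toAlg U s) ∈ Δ.stalk w := by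
    rw [h]
    exact (hJ U s).mp hs i
  have hlift (i : Fin l) (Δ : CartierDivisor P) (h : Δ = (i : ℕ) • M - divExp l n i • E) :
      ∃ a : Δ.lineBundle ⟶ (Scheme.Modules.pushforward ψ).obj (idealSheaf J),
        a ≫ pushforwardIdealι ψ J = hX.monomialHom i Δ (hmono i Δ h) := by
    refine exists_lift_pushforwardIdeal ψ J _ fun U s => ?_
    by_cases hU : Nonempty U
    · refine (hJ U _).mpr fun j w hw => ?_
      rw [hX.toAlg_monomialHom i Δ (hmono i Δ h) U s ⟨w, hw⟩, rootCoord_of_mul, rootCoord_root_pow]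
      split_ifs with hij
      · rw [mul_one, ← hij, ← h]
        exact (show Δ.sections U from s).2.2 ⟨w, hw⟩
      · rw [mul_zero]
        exact zero_mem _
    · refine TopCat.Presheaf.section_ext J.subscheme.sheaf _ _ _ fun x hx => ?_
      exact absurd ⟨⟨ψ (J.subschemeι x), hx⟩⟩ hU
  have h₁ (i : Fin r) : (i : ℕ) • M - (q + 1) • E = (i : ℕ) • M - divExp l n i • E := by
    rw [hexp₁ i i.2]
  have h₂ (i : Fin (l - r)) : (r + (i : ℕ)) • M - q • E =
      (r + (i : ℕ)) • M - divExp l n (r + i) • E := by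
    rw [hexp₂ (r + i) (by omega) (by omega)]
  choose a ha using fun i : Fin r => hlift ⟨i, i.2.trans hr⟩ _ (h₁ i)
  choose a' ha' using fun i : Fin (l - r) => hlift ⟨r + i, by omega⟩ _ (h₂ i)
  refine nonempty_iso_biprod_biproduct a a'
    (fun i => hX.coeffHom J ⟨i, i.2.trans hr⟩ _ (hcoeff ⟨i, i.2.trans hr⟩ _ (h₁ i)))
    (fun i => hX.coeffHom J ⟨r + i, by omega⟩ _ (hcoeff ⟨r + i, by omega⟩ _ (h₂ i)))
    (fun i => hX.monomialHom_coeffHom_same J _ _ _ _ (ha i))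
    (fun i => hX.monomialHom_coeffHom_same J _ _ _ _ (ha' i))
    (fun i j hij => hX.monomialHom_coeffHom_ne J (fun h => hij ?_) _ _ _ _ (ha i))
    (fun i j hij => hX.monomialHom_coeffHom_ne J (fun h => hij ?_) _ _ _ _ (ha' i))
    (fun i j => hX.monomialHom_coeffHom_ne J (fun h => ?_) _ _ _ _ (ha i))
    (fun i j => hX.monomialHom_coeffHom_ne J (fun h => ?_) _ _ _ _ (ha' i)) ?_
  · exact Fin.ext (Fin.mk.inj h)
  · exact Fin.ext (Nat.add_left_cancel (Fin.mk.inj h))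
  · have := Fin.mk.inj h
    omega
  · have := Fin.mk.inj h
    omega
  -- Inside `ψ_* 𝒪_X` the identity to be proved says that an element is the sum of its terms `gᵢ
  -- Tⁱ`.
  · rw [← cancel_mono (pushforwardIdealι ψ J), Category.id_comp, Preadditive.add_comp,
      Preadditive.sum_comp, Preadditive.sum_comp]
    simp only [Category.assoc, ha, ha']
    refine modulesHom_ext fun U s => hX.section_ext fun hU => ?_
    -- Evaluation is packaged as an additive map of morphisms so that it passes through the finite
    -- sums.
    let ev : ((Scheme.Modules.pushforward ψ).obj (idealSheaf J) ⟶
        (Scheme.Modules.pushforward ψ).obj (structureModule X)) →+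
        GenericAlgebra l (θ : P.functionField) :=
      (hX.toAlg U : Γ(X, ψ ⁻¹ᵁ U) →+ GenericAlgebra l (θ : P.functionField)).comp
        (modulesHomEval U s)
    have hev (φ) : hX.toAlg U (φ.app U s) = ev φ := rfl
    refine (hev _).trans ?_
    rw [map_add, map_sum, map_sum]
    refine Eq.trans ?_ (sum_rootCoord_split hr (hX.toAlg U ((pushforwardIdealι ψ J).app U s)))
    congr 1
    · refine Finset.sum_congr rfl fun i _ => ?_
      exact (hev _).symm.trans (hX.toAlg_coeffHom_comp_monomialHom J _ _ _ _ U s)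
    · refine Finset.sum_congr rfl fun i _ => ?_
      exact (hev _).symm.trans (hX.toAlg_coeffHom_comp_monomialHom J _ _ _ _ U s)

end Decomposition

/-- The quotient by the kernel embeds in a ring of sections of the reduced scheme `C`. -/
lemma isRadical_ker_app {C P : Scheme.{u}} [IsIntegral C] (σ : C ⟶ P) (U : P.Opens) :
    (RingHom.ker (σ.app U).hom).IsRadical := by
  rintro s ⟨N, hN⟩
  rw [RingHom.mem_ker, map_pow] at hN
  rw [RingHom.mem_ker]
  exact IsReduced.eq_zero _ ⟨N, hN⟩

end TangoCover

end

/-! ### The Tango data satisfy the hypotheses of the local computation -/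

theorem mainTheorem3
    {k : Type u} [Field k] [IsAlgClosed k] (p : ℕ) [Fact p.Prime] [CharP k p]
    -- a Tango curve `C` with Tango structure `L = 𝒪_C(D)`, `(df) = pD`
    {C : Scheme.{u}} [IsIntegral C] (c : C ⟶ Spec (.of k)) [IsProper c]
    [SmoothOfRelativeDimension 1 c]
    (D : CartierDivisor C) (f : C.functionField)
    (hD : IsTangoStructure c p D f)
    -- the ruled surface `P = ℙ(ℰ)` of the extension `ℰ` of `L` by `𝒪_C` with class `β(df)`
    (e : C → C.functionField) (he : RepresentsTangoClass p D f e)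
    {P : Scheme.{u}} [IsIntegral P] (π : P ⟶ C) [IsDominant π] (y : P.functionField)
    (hP : IsProjectiveBundle π D e y)
    (H : CartierDivisor P) (hH : IsTautologicalDivisor π D e y H)
    -- the section `E` and the multisection `B`
    (σ : C ⟶ P) (hσ : IsQuotientSection π D e y σ)
    (E : CartierDivisor P) (hE : E.IsDivisorOf σ.ker)
    (τ : P.functionFieldˣ) (hτ : (τ : P.functionField) = functionFieldMap π f + y ^ p)
    (B : CartierDivisor P) (hB : B = multisection π p D H τ)
    -- `M = 𝒪_P(-m) ⊗ π^*Nᵖ` with `Nˡ ≅ L`, and an isomorphism `Mˡ ≅ 𝒪_P(-E - B)`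
    (l m : ℕ) (hlm : l * m = p + 1)
    (N : CartierDivisor C)
    (hN : ∃ w : C.functionFieldˣ, l • N = D + principalDivisor w)
    (M : CartierDivisor P) (hM : M = -(m • H) + p • N.pullback π)
    (θ : P.functionFieldˣ) (hθ : principalDivisor θ = l • M + (E + B))
    -- the cyclic cover `X`
    {X : Scheme.{u}} (ψ : X ⟶ P) (hX : CyclicCover ψ l M θ)
    (n q r : ℕ) (hn : 0 < n) (hnqr : n = q * l + r) (hr : r < l) :
    Nonempty ((Scheme.Modules.pushforward ψ).obj
        (idealSheaf (reducedPreimage ψ σ.ker.support ^ n)) ≅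
      (⨁ fun i : Fin r => ((i : ℕ) • M - (q + 1) • E).lineBundle) ⊞
        (⨁ fun i : Fin (l - r) => ((r + (i : ℕ)) • M - q • E).lineBundle)) := by

  have hl : NeZero l := ⟨by omega⟩
  have hcp := hσ.isClosedImmersion hP
  have : CharP P.functionField p :=
    charP_of_injective_ringHom ((functionFieldMap π).comp (scalarMap c)).injective p
  obtain ⟨w, hw⟩ := hN
  have hNπ : l • N.pullback π = D.pullback π +
      principalDivisor (Units.map (functionFieldMap π).toMonoidHom w) := by
    rw [← CartierDivisor.pullback_nsmul, hw, CartierDivisor.pullback_add,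
      CartierDivisor.pullback_principalDivisor]
  set w' : P.functionFieldˣ := Units.map (functionFieldMap π).toMonoidHom w
  have hlM : l • M = -((p + 1) • H) + p • (D.pullback π + principalDivisor w') := by
    rw [hM, ← hNπ, smul_add, smul_neg, ← mul_smul, hlm, ← mul_smul, ← mul_smul, mul_comm p l]
  -- From `E = div θ - lM - B` the terms `(p + 1) H` and `-pH` leave one `H`, the multiples of
  -- `π^*D` cancel, and `τ` and `w'ᵖ` remain as principal corrections.
  have hEH : E = H + principalDivisor (θ * (τ * w' ^ p)⁻¹) := by
    rw [principalDivisor_mul, principalDivisor_inv, principalDivisor_mul, principalDivisor_pow, hθ,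
      hlM, hB, multisection, add_smul, one_smul, smul_add]
    abel
  obtain rfl : E = H := eq_of_isDivisorOf_ker hP he.coherent c hH hσ hE hEH
  have hsupp : ∀ z ∈ σ.ker.support, B.eqn z = 1 := by
    intro z hz
    have hz' : z ∈ closure (Set.range σ) := by
      rw [← Scheme.Hom.support_ker]
      exact hz
    rw [σ.isClosedEmbedding.isClosed_range.closure_eq] at hz'
    obtain ⟨x, rfl⟩ := hz'
    rw [hB]
    exact eqn_multisection_eq_one hP he.lift hH hσ hτ x
  have hrad : ∀ U, (σ.ker.ideal U).IsRadical := by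
    intro U
    rw [Scheme.Hom.ker_apply]
    exact isRadical_ker_app σ U
  exact hX.nonempty_pushforward_iso _ hH.one_mem_stalk hnqr hr fun U _ s =>
    hX.app_subschemeι_eq_zero_iff hrad hE hH.one_mem_stalk hθ hsupp n U s
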